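/- **Setting.** Let $n\ge 2$ and let $\mathfrak m=E\oplus\mathbb R\mathfrak p\oplus\mathbb R\mathfrak q$ be Minkowski space of dimension $n+1$, where $\langle\cdot,\cdot\rangle$ is negative definite on $E$, $\dim E=n-1$, $\mathfrak p,\mathfrak q$ are isotropic and orthogonal to $E$, and $\langle \mathfrak p,\mathfrak q\rangle=1$. Write $e^\flat=\langle e,\cdot\rangle|_E\in E^*$ for $e\in E$. Let $b$ be a non-degenerate symmetric bilinear form on $E$ and define $B\in\mathrm{End}(E)$ by $b(e,f)=-\langle Be,f\rangle$. The Cahen–Wallach algebra $\mathfrak g_b=E^*+(E+\mathbb R\mathfrak p+\mathbb R\mathfrak q)$ is the Lie algebra whose only non-trivial brackets are $[\mathfrak q,e]=e^\flat$, $[e^\flat,f]=b(e,f)\mathfrak p$, $[e^\flat,\mathfrak q]=Be$. Clifford algebras are taken with $v^2=-\langle v,v\rangle$, and $\mathfrak{so}$ is embedded in them by $v\wedge w=\langle v,\cdot\rangle w-\langle w,\cdot\rangle v\mapsto\frac14(vw-wv)$. Let $\rho_{0,n-1}:\mathrm{Cl}_{0,n-1}=\mathrm{Cl}(E)\to\mathrm{End}_{\mathbb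 R}(S_{0,n-1})$ be a real irreducible representation; for $c\in\mathrm{Cl}_{0,n-1}$ write $c$ also for $\rho_{0,n-1}(c)$. Let $S=S_-+S_+=S_{0,n-1}+S_{0,n-1}$, with elements $Q=\binom{Q_-}{Q_+}$, carry the representation $\rho_{\rm spin}$ of $\mathrm{Cl}(\mathfrak m)$ given by $e\mapsto\begin{pmatrix}-e&0\\0&e\end{pmatrix}$ for $e\in E$, $\mathfrak p\mapsto\begin{pmatrix}0&2\sqrt2\\0&0\end{pmatrix}$, $\mathfrak q\mapsto\begin{pmatrix}0&0\\-1/\sqrt2&0\end{pmatrix}$. A *superization* of $\mathfrak g_b$ is a real Lie superalgebra $\mathfrak g=\mathfrak g_{\bar0}+\mathfrak g_{\bar1}$ with $\mathfrak g_{\bar0}=\mathfrak g_b$ and $\mathfrak g_{\bar1}=S$ such that $\mathrm{ad}_{e^\flat}|_S=\rho_{\rm spin}(\mathfrak p\wedge Be)$ for all $e\in E$. It has *zero charge* if $\mathrm{ad}_{\mathfrak p}|_S=0$ and, as is part of the convention for zero charge, $\mathrm{ad}_{v}|_S\in\rho_{\rm spin}(\mathrm{Cl}(\mathfrak m))$ for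 all $v\in\mathfrak m$. It has *translational supersymmetry* if $[S,S]\subseteq\mathfrak m$. If the $\mathfrak{so}(E)$-module $S_{0,n-1}$ is reducible, fix a decomposition $S_{0,n-1}=S^-+S^+$ into semi-spinors, i.e. complementary irreducible $\mathfrak{so}(E)$-submodules which are exchanged by Clifford multiplication by vectors of $E$. An $\mathfrak{so}(E)$-invariant bilinear form $\Gamma$ on $S_{0,n-1}$ is *admissible* with invariants $\tau,\sigma\in\{\pm1\}$ if $\Gamma(v s,t)=\tau\,\Gamma(s,v t)$ for $v\in E$, $\Gamma(s,t)=\sigma\,\Gamma(t,s)$ and, when $S_{0,n-1}$ is a reducible $\mathfrak{so}(E)$-module, $S^\pm$ are either mutually orthogonal or both isotropic for $\Gamma$. Let $\mathrm{Bil}(S_{0,n-1})^{\tau\sigma=-1}$ be the vector space spanned by the admissible forms with $\tau\sigma=-1$. A pair $(c_1,c_2)\in(\mathrm{Cl}_{0,n-1})^2$ solves the *quadratic Clifford equation* if $(L_{c_1}-R_{c_2})^2E\subseteq E$ and $(L_{c_1}-R_{c_2})^2|_E=-B$, where $L_c$ and $R_c$ denote left and right multiplication by $c$. **Theorem 5.1.**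 Consider the data $(c_1,c_2,c_3,p_{-+},p_{++})$ consisting of a solution $(c_1,c_2)\in(\mathrm{Cl}_{0,n-1})^2$ of the quadratic Clifford equation, an element $c_3\in\mathrm{Cl}_{0,n-1}$, a form $p_{-+}\in\mathrm{Bil}(S_{0,n-1})^{\tau\sigma=-1}$ and a symmetric bilinear form $p_{++}$ on $S_{0,n-1}$, which satisfy for all $s,t\in S_{0,n-1}$ $$p_{-+}(c_3s,t)+p_{-+}(c_3t,s)+p_{++}(c_2s,t)+p_{++}(s,c_2t)=0,\qquad p_{-+}(c_1s,t)+p_{-+}(s,c_2t)=0.$$ 1. For all such data there is exactly one superization of $\mathfrak g_b$ with $$\mathrm{ad}_{\mathfrak p}|_S=0,\quad \mathrm{ad}_{\mathfrak q}|_S=\begin{pmatrix}c_1&c_3\\0&c_2\end{pmatrix},\quad \mathrm{ad}_{e^\flat}|_S=\sqrt2\begin{pmatrix}0&Be\\0&0\end{pmatrix},\quad \mathrm{ad}_e|_S=\sqrt2\begin{pmatrix}0&e\circ c_2-c_1\circ e\\0&0\end{pmatrix}\quad(e\in E),$$ $$[Q,Q]=\bigl(p_{++}(Q_+,Q_+)+2p_{-+}(Q_-,Q_+)\bigr)\mathfrak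 p\quad(Q\in S),$$ and it has zero charge and translational supersymmetry. 2. Every zero charge superization of $\mathfrak g_b$ with translational supersymmetry is given by these formulas for some such data. 3. Two such data $(c_1,c_2,c_3,p_{-+},p_{++})$ and $(c_1',c_2',c_3',p_{-+}',p_{++}')$ define the same superization if and only if $p_{-+}=p_{-+}'$, $p_{++}=p_{++}'$ and $c_i-c_i'\in\ker\rho_{0,n-1}$ for $i=1,2,3$. -/

import Mathlib

noncomputable section

namespace CahenWallach

/-! ### Clifford algebras with the convention `v * v = -⟨v, v⟩` -/

/-- The quadratic form `v ↦ -⟨v, v⟩` attached to a scalar product `⟨·, ·⟩`. -/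
def clForm {M : Type*} [AddCommGroup M] [Module ℝ M] (g : LinearMap.BilinForm ℝ M) :
    QuadraticForm ℝ M :=
  LinearMap.BilinMap.toQuadraticMap (-g)

/-- The Clifford algebra of `(M, g)`: the tensor algebra of `M` modulo `v ⊗ v + ⟨v, v⟩`. -/
abbrev Cl {M : Type*} [AddCommGroup M] [Module ℝ M] (g : LinearMap.BilinForm ℝ M) : Type _ :=
  CliffordAlgebra (clForm g)

/-- The inclusion of `M` into its Clifford algebra. -/
abbrev vec {M : Type*} [AddCommGroup M] [Module ℝ M] (g : LinearMap.BilinForm ℝ M) :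
    M →ₗ[ℝ] Cl g :=
  CliffordAlgebra.ι (clForm g)

/-- The image `[v, w] / 4` of `v ∧ w = ⟨v, ·⟩ w - ⟨w, ·⟩ v ∈ so(M)` under the natural embedding of
`so(M)` into the Clifford algebra. -/
def soCl {M : Type*} [AddCommGroup M] [Module ℝ M] (g : LinearMap.BilinForm ℝ M) (v w : M) :
    Cl g :=
  (1 / 4 : ℝ) • (vec g v * vec g w - vec g w * vec g v)

theorem clForm_apply {M : Type*} [AddCommGroup M] [Module ℝ M] (g : LinearMap.BilinForm ℝ M)
    (v : M) : clForm g v = -g v v := rfl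

/-! ### The Minkowski space `𝔪 = E ⊕ ℝp ⊕ ℝq` -/

section Minkowski

variable (E : Type*) [NormedAddCommGroup E] [InnerProductSpace ℝ E]

/-- The negative definite scalar product `⟨·, ·⟩` on the Euclidean space `E`. -/
def euc : LinearMap.BilinForm ℝ E := -innerₗ E

theorem euc_apply (e f : E) : euc E e f = -inner ℝ e f := rfl

theorem euc_nondegenerate : (euc E).Nondegenerate := by
  refine ⟨fun e he => ?_, fun e he => ?_⟩
  all_goals
    have h := he e
    rw [euc_apply, neg_eq_zero] at h
    exact inner_self_eq_zero.mp h

/-- The vector space underlying `𝔪`: the triple `(e, a, s)` stands for `e + a p + s q`. -/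
abbrev Mink : Type _ := E × ℝ × ℝ

/-- The Lorentzian scalar product on `𝔪`: it restricts to `⟨·, ·⟩` on `E`, the vectors `p` and `q`
are isotropic and orthogonal to `E`, and `⟨p, q⟩ = 1`. -/
def mink : LinearMap.BilinForm ℝ (Mink E) :=
  LinearMap.mk₂ ℝ (fun v w => euc E v.1 w.1 + v.2.1 * w.2.2 + v.2.2 * w.2.1)
    (by intro v v' w; simp; ring) (by intro c v w; simp; ring)
    (by intro v w w'; simp; ring) (by intro c v w; simp; ring)

theorem mink_apply (v w : Mink E) :
    mink E v w = euc E v.1 w.1 + v.2.1 * w.2.2 + v.2.2 * w.2.1 := rfl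

variable [FiniteDimensional ℝ E]

/-- The musical isomorphism `e ↦ e♭ = ⟨e, ·⟩`; its inverse is `♯`. -/
def flat : E ≃ₗ[ℝ] Module.Dual ℝ E := (euc E).toDual (euc_nondegenerate E)

theorem flat_apply (e f : E) : flat E e f = euc E e f := rfl

end Minkowski

/-! ### The Cahen-Wallach Lie algebra -/

/-- A non-degenerate symmetric bilinear form `b` on `E`. -/
structure CWForm (E : Type*) [NormedAddCommGroup E] [InnerProductSpace ℝ E] where
  form : LinearMap.BilinForm ℝ E
  symm : ∀ e f, form e f = form f e
  nondeg : form.Nondegenerate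

section Algebra

variable {E : Type*} [NormedAddCommGroup E] [InnerProductSpace ℝ E]

/-- The endomorphism `B` of `E` defined by `b(e, f) = -⟨B e, f⟩`. -/
def CWForm.B [FiniteDimensional ℝ E] (b : CWForm E) : E →ₗ[ℝ] E := -((flat E).symm.toLinearMap ∘ₗ b.form)

theorem CWForm.form_eq [FiniteDimensional ℝ E] (b : CWForm E) (e f : E) : b.form e f = -euc E (b.B e) f := by
  have h : flat E ((flat E).symm (b.form e)) f = b.form e f := by simp
  rw [flat_apply] at h
  simp [CWForm.B, h]

/-- The vector space `E* + (E + ℝp + ℝq)` underlying the Cahen-Wallach algebra: the pair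
`(ξ, (e, a, s))` stands for `ξ + e + a p + s q`. -/
def CWAlg (_b : CWForm E) : Type _ := Module.Dual ℝ E × Mink E

variable (b : CWForm E)

instance : AddCommGroup (CWAlg b) := inferInstanceAs (AddCommGroup (Module.Dual ℝ E × Mink E))

instance : Module ℝ (CWAlg b) := inferInstanceAs (Module ℝ (Module.Dual ℝ E × Mink E))

/-- The inclusion of `𝔥 = E*`. -/
def inDual : Module.Dual ℝ E →ₗ[ℝ] CWAlg b := LinearMap.inl ℝ (Module.Dual ℝ E) (Mink E)

/-- The inclusion of `𝔪`. -/
def inMink : Mink E →ₗ[ℝ] CWAlg b := LinearMap.inr ℝ (Module.Dual ℝ E) (Mink E)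

/-- The inclusion of `E`. -/
def inE (e : E) : CWAlg b := inMink b (e, 0, 0)

/-- The central element `p`. -/
def elP : CWAlg b := inMink b (0, 1, 0)

/-- The element `q`. -/
def elQ : CWAlg b := inMink b (0, 0, 1)

theorem CWAlg.ext {x y : CWAlg b} (h1 : x.1 = y.1) (h2 : x.2.1 = y.2.1)
    (h3 : x.2.2.1 = y.2.2.1) (h4 : x.2.2.2 = y.2.2.2) : x = y :=
  Prod.ext h1 (Prod.ext h2 (Prod.ext h3 h4))

theorem add_c1 (x y : CWAlg b) : (x + y).1 = x.1 + y.1 := rfl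
theorem add_c2 (x y : CWAlg b) : (x + y).2.1 = x.2.1 + y.2.1 := rfl
theorem add_c3 (x y : CWAlg b) : (x + y).2.2.1 = x.2.2.1 + y.2.2.1 := rfl
theorem add_c4 (x y : CWAlg b) : (x + y).2.2.2 = x.2.2.2 + y.2.2.2 := rfl
theorem smul_c1 (r : ℝ) (x : CWAlg b) : (r • x).1 = r • x.1 := rfl
theorem smul_c2 (r : ℝ) (x : CWAlg b) : (r • x).2.1 = r • x.2.1 := rfl
theorem smul_c3 (r : ℝ) (x : CWAlg b) : (r • x).2.2.1 = r * x.2.2.1 := rfl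
theorem smul_c4 (r : ℝ) (x : CWAlg b) : (r • x).2.2.2 = r * x.2.2.2 := rfl

variable [FiniteDimensional ℝ E]

/-- The bilinear skew-symmetric bracket with `[q, e] = e♭`, `[e♭, f] = b(e, f) p`,
`[e♭, q] = B e`, all other brackets of elements of `E*`, `E`, `p`, `q` being zero. -/
def cwBracket (x y : CWAlg b) : CWAlg b :=
  (x.2.2.2 • flat E y.2.1 - y.2.2.2 • flat E x.2.1,
    (y.2.2.2 • b.B ((flat E).symm x.1) - x.2.2.2 • b.B ((flat E).symm y.1),
      b.form ((flat E).symm x.1) y.2.1 - b.form ((flat E).symm y.1) x.2.1, 0))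

theorem br_c1 (x y : CWAlg b) :
    (cwBracket b x y).1 = x.2.2.2 • flat E y.2.1 - y.2.2.2 • flat E x.2.1 := rfl
theorem br_c2 (x y : CWAlg b) : (cwBracket b x y).2.1 =
    y.2.2.2 • b.B ((flat E).symm x.1) - x.2.2.2 • b.B ((flat E).symm y.1) := rfl
theorem br_c3 (x y : CWAlg b) : (cwBracket b x y).2.2.1 =
    b.form ((flat E).symm x.1) y.2.1 - b.form ((flat E).symm y.1) x.2.1 := rfl
theorem br_c4 (x y : CWAlg b) : (cwBracket b x y).2.2.2 = 0 := rfl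

instance : LieRing (CWAlg b) where
  bracket := cwBracket b
  add_lie x y z := by
    refine CWAlg.ext b ?_ ?_ ?_ ?_ <;>
      simp only [br_c1, br_c2, br_c3, br_c4, add_c1, add_c2, add_c3, add_c4, map_add,
        LinearMap.add_apply] <;> module
  lie_add x y z := by
    refine CWAlg.ext b ?_ ?_ ?_ ?_ <;>
      simp only [br_c1, br_c2, br_c3, br_c4, add_c1, add_c2, add_c3, add_c4, map_add,
        LinearMap.add_apply] <;> module
  lie_self x := by
    refine CWAlg.ext b ?_ ?_ ?_ ?_ <;> simp only [br_c1, br_c2, br_c3, br_c4, sub_self] <;> rfl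
  leibniz_lie x y z := by
    have h4 := b.symm x.2.1 y.2.1
    have h5 := b.symm x.2.1 z.2.1
    have h6 := b.symm y.2.1 z.2.1
    have k1 : ∀ u v, b.form u (b.B v) = b.form v (b.B u) := by
      intro u v
      rw [b.form_eq, b.form_eq, euc_apply, euc_apply, real_inner_comm]
    have k2 := k1 ((flat E).symm x.1) ((flat E).symm y.1)
    have k3 := k1 ((flat E).symm x.1) ((flat E).symm z.1)
    have k4 := k1 ((flat E).symm y.1) ((flat E).symm z.1)
    refine CWAlg.ext b ?_ ?_ ?_ ?_ <;>
      simp only [br_c1, br_c2, br_c3, br_c4, add_c1, add_c2, add_c3, add_c4, map_sub,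
        map_smul, LinearMap.sub_apply, LinearMap.smul_apply, smul_eq_mul,
        LinearEquiv.symm_apply_apply]
    · module
    · module
    · rw [h4, h5, h6, k2, k3, k4]; ring
    · ring

instance : LieAlgebra ℝ (CWAlg b) where
  lie_smul r x y := by
    change cwBracket b x (r • y) = r • cwBracket b x y
    refine CWAlg.ext b ?_ ?_ ?_ ?_ <;>
      simp only [br_c1, br_c2, br_c3, br_c4, smul_c1, smul_c2, smul_c3, smul_c4, map_smul,
        LinearMap.smul_apply, smul_eq_mul]
    · module
    · module
    · ring
    · ring

theorem lie_def (x y : CWAlg b) : ⁅x, y⁆ = cwBracket b x y := rfl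

end Algebra

/-! ### Spin modules -/

section Spin

variable {E : Type*} [NormedAddCommGroup E] [InnerProductSpace ℝ E]
variable {V : Type*} [AddCommGroup V] [Module ℝ V]

/-- `V` is a real irreducible `Cl(E)`-module, i.e. a model of the spin module `S_{0,n-1}`. -/
def IsSpinModule (ρ : Cl (euc E) →ₐ[ℝ] Module.End ℝ V) : Prop :=
  Nontrivial V ∧
    ∀ W : Submodule ℝ V, (∀ c, ∀ s ∈ W, ρ c s ∈ W) → W = ⊥ ∨ W = ⊤

/-- The endomorphism of `S = S₋ + S₊ = V + V` with the block matrix `(x y; z t)`. -/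
def block (x y z t : Module.End ℝ V) : Module.End ℝ (V × V) :=
  (x ∘ₗ LinearMap.fst ℝ V V + y ∘ₗ LinearMap.snd ℝ V V).prod
    (z ∘ₗ LinearMap.fst ℝ V V + t ∘ₗ LinearMap.snd ℝ V V)

theorem block_apply (x y z t : Module.End ℝ V) (Q : V × V) :
    block x y z t Q = (x Q.1 + y Q.2, z Q.1 + t Q.2) := rfl

/-- The action of the vectors of `𝔪` on `S = V + V`: a vector `e` of `E` acts by `(-e 0; 0 e)`,
`p` by `(0 2√2; 0 0)` and `q` by `(0 0; -1/√2 0)`. -/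
def minkAct (ρ : Cl (euc E) →ₐ[ℝ] Module.End ℝ V) : Mink E →ₗ[ℝ] Module.End ℝ (V × V) where
  toFun v := block (-ρ (vec _ v.1)) ((2 * √2 * v.2.1) • 1) ((-(1 / √2) * v.2.2) • 1)
    (ρ (vec _ v.1))
  map_add' v w := by
    refine LinearMap.ext fun Q => Prod.ext ?_ ?_ <;> simp [block_apply] <;> module
  map_smul' r v := by
    refine LinearMap.ext fun Q => Prod.ext ?_ ?_ <;> simp [block_apply] <;> module

theorem minkAct_sq (ρ : Cl (euc E) →ₐ[ℝ] Module.End ℝ V) (v : Mink E) :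
    minkAct ρ v * minkAct ρ v = algebraMap ℝ _ (clForm (mink E) v) := by
  have h : ∀ s : V, ρ (vec _ v.1) (ρ (vec _ v.1) s) = (-euc E v.1 v.1) • s := by
    intro s
    have h1 : ρ (vec (euc E) v.1 * vec (euc E) v.1) s = (-euc E v.1 v.1) • s := by
      rw [CliffordAlgebra.ι_sq_scalar, clForm_apply, AlgHom.commutes]
      rfl
    rw [← h1, map_mul]; rfl
  have h2 : 2 * √2 * v.2.1 * (-(1 / √2) * v.2.2) = -2 * v.2.1 * v.2.2 := by
    have : √2 ≠ 0 := by positivity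
    field_simp
  have h3 : clForm (mink E) v = -euc E v.1 v.1 + 2 * √2 * v.2.1 * (-(1 / √2) * v.2.2) := by
    rw [h2, clForm_apply, mink_apply]; ring
  refine LinearMap.ext fun Q => ?_
  rw [h3, Module.algebraMap_end_apply]
  refine Prod.ext ?_ ?_
  · change -ρ (vec _ v.1) (-ρ (vec _ v.1) Q.1 + (2 * √2 * v.2.1) • Q.2) + (2 * √2 * v.2.1) •
      ((-(1 / √2) * v.2.2) • Q.1 + ρ (vec _ v.1) Q.2) = _ • Q.1
    rw [map_add, map_neg, map_smul, h]
    module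
  · change (-(1 / √2) * v.2.2) • (-ρ (vec _ v.1) Q.1 + (2 * √2 * v.2.1) • Q.2) + ρ (vec _ v.1)
      ((-(1 / √2) * v.2.2) • Q.1 + ρ (vec _ v.1) Q.2) = _ • Q.2
    rw [map_add, map_smul, h]
    module

/-- The spin representation of `Cl(𝔪)` on `S = V + V`. -/
def spinRep (ρ : Cl (euc E) →ₐ[ℝ] Module.End ℝ V) :
    Cl (mink E) →ₐ[ℝ] Module.End ℝ (V × V) :=
  CliffordAlgebra.lift _ ⟨minkAct ρ, minkAct_sq ρ⟩

/-- The operator `ρ_spin(i_b(ξ))` on `S`, where `i_b(e♭) = p ∧ B e` is the isotropy representation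
of `E*`, given by the adjoint action of `E*` on `𝔪`. -/
def isotropySpin [FiniteDimensional ℝ E] (b : CWForm E) (ρ : Cl (euc E) →ₐ[ℝ] Module.End ℝ V)
    (ξ : Module.Dual ℝ E) : Module.End ℝ (V × V) :=
  spinRep ρ (soCl (mink E) (0, 1, 0) (b.B ((flat E).symm ξ), 0, 0))

/-- `W` is an `so(E)`-submodule of `V`. -/
def SoStable (ρ : Cl (euc E) →ₐ[ℝ] Module.End ℝ V) (W : Submodule ℝ V) : Prop :=
  ∀ v w : E, ∀ s ∈ W, ρ (soCl (euc E) v w) s ∈ W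

/-- `W` is an irreducible `so(E)`-submodule of `V`. -/
def SoIrreducible (ρ : Cl (euc E) →ₐ[ℝ] Module.End ℝ V) (W : Submodule ℝ V) : Prop :=
  SoStable ρ W ∧ W ≠ ⊥ ∧ ∀ U ≤ W, SoStable ρ U → U = ⊥ ∨ U = W

/-- `V = S⁻ + S⁺` is a decomposition into semi-spinors: `S⁻` and `S⁺` are complementary
irreducible `so(E)`-submodules, and Clifford multiplication by vectors exchanges them. -/
structure IsSemispinorSplitting (ρ : Cl (euc E) →ₐ[ℝ] Module.End ℝ V)
    (Sm Sp : Submodule ℝ V) : Prop where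
  compl : IsCompl Sm Sp
  irr_minus : SoIrreducible ρ Sm
  irr_plus : SoIrreducible ρ Sp
  odd_minus : ∀ v : E, ∀ s ∈ Sm, ρ (vec _ v) s ∈ Sp
  odd_plus : ∀ v : E, ∀ s ∈ Sp, ρ (vec _ v) s ∈ Sm

/-- Admissible bilinear forms on `V` of type `τ` and symmetry `σ`. The semi-spinors `Sm`, `Sp`
only matter when the `so(E)`-module `V` is reducible. -/
structure IsAdmissible (ρ : Cl (euc E) →ₐ[ℝ] Module.End ℝ V) (Sm Sp : Submodule ℝ V)
    (τ σ : ℤˣ) (Γ : LinearMap.BilinForm ℝ V) : Prop where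
  invariant : ∀ (v w : E) (s t : V),
    Γ (ρ (soCl (euc E) v w) s) t + Γ s (ρ (soCl (euc E) v w) t) = 0
  type : ∀ (v : E) (s t : V), Γ (ρ (vec _ v) s) t = (τ : ℤ) * Γ s (ρ (vec _ v) t)
  symmetry : ∀ s t : V, Γ s t = (σ : ℤ) * Γ t s
  isotropy : ¬ SoIrreducible ρ (⊤ : Submodule ℝ V) →
    (∀ s ∈ Sm, ∀ t ∈ Sp, Γ s t = 0 ∧ Γ t s = 0) ∨
      ((∀ s ∈ Sm, ∀ t ∈ Sm, Γ s t = 0) ∧ ∀ s ∈ Sp, ∀ t ∈ Sp, Γ s t = 0)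

/-- The vector space of bilinear forms on `V` spanned by the admissible ones with `τσ = -1`. -/
def bilTauSigmaNeg (ρ : Cl (euc E) →ₐ[ℝ] Module.End ℝ V) (Sm Sp : Submodule ℝ V) :
    Submodule ℝ (LinearMap.BilinForm ℝ V) :=
  Submodule.span ℝ {Γ | ∃ τ σ : ℤˣ, τ * σ = -1 ∧ IsAdmissible ρ Sm Sp τ σ Γ}

end Spin

/-! ### Lie superalgebras and superizations -/

/-- The homogeneous parts of the `ℤ/2`-graded vector space `A₀ + A₁`. -/
def parityPart (A₀ A₁ : Type*) [AddCommGroup A₀] [Module ℝ A₀] [AddCommGroup A₁] [Module ℝ A₁]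
    (i : ZMod 2) : Submodule ℝ (A₀ × A₁) :=
  if i = 0 then LinearMap.range (LinearMap.inl ℝ A₀ A₁) else LinearMap.range (LinearMap.inr ℝ A₀ A₁)

/-- Real Lie superalgebra structures on the `ℤ/2`-graded vector space `A₀ + A₁`. -/
structure LieSuperalgebraOn (A₀ A₁ : Type*) [AddCommGroup A₀] [Module ℝ A₀] [AddCommGroup A₁]
    [Module ℝ A₁] where
  br : (A₀ × A₁) →ₗ[ℝ] (A₀ × A₁) →ₗ[ℝ] (A₀ × A₁)
  graded : ∀ i j : ZMod 2, ∀ x ∈ parityPart A₀ A₁ i, ∀ y ∈ parityPart A₀ A₁ j,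
    br x y ∈ parityPart A₀ A₁ (i + j)
  skew : ∀ i j : ZMod 2, ∀ x ∈ parityPart A₀ A₁ i, ∀ y ∈ parityPart A₀ A₁ j,
    br x y = -((-1 : ℝ) ^ (i.val * j.val) • br y x)
  jacobi : ∀ i j : ZMod 2, ∀ x ∈ parityPart A₀ A₁ i, ∀ y ∈ parityPart A₀ A₁ j, ∀ z,
    br x (br y z) = br (br x y) z + (-1 : ℝ) ^ (i.val * j.val) • br y (br x z)

section Superization

variable {E : Type*} [NormedAddCommGroup E] [InnerProductSpace ℝ E] [FiniteDimensional ℝ E]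
variable {V : Type*} [AddCommGroup V] [Module ℝ V]

/-- Superizations of the Cahen-Wallach algebra: Lie superalgebras whose even part is this Lie
algebra, whose odd part is `S = V + V`, and such that the adjoint action of the even part on the
odd part is a spin representation. -/
structure Superization (b : CWForm E) (ρ : Cl (euc E) →ₐ[ℝ] Module.End ℝ V)
    extends LieSuperalgebraOn (CWAlg b) (V × V) where
  even_part : ∀ x y : CWAlg b, br (x, 0) (y, 0) = (⁅x, y⁆, 0)
  spin : ∀ (ξ : Module.Dual ℝ E) (Q : V × V),
    br (inDual b ξ, 0) (0, Q) = (0, isotropySpin b ρ ξ Q)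

variable {b : CWForm E} {ρ : Cl (euc E) →ₐ[ℝ] Module.End ℝ V}

/-- The adjoint action `ad_x|_S` of an even element on the odd part. -/
def Superization.adOdd (g : Superization b ρ) (x : CWAlg b) : Module.End ℝ (V × V) :=
  LinearMap.snd ℝ (CWAlg b) (V × V) ∘ₗ g.br (x, 0) ∘ₗ LinearMap.inr ℝ (CWAlg b) (V × V)

/-- The bracket of two odd elements. -/
def Superization.oddBr (g : Superization b ρ) (Q Q' : V × V) : CWAlg b :=
  (g.br (0, Q) (0, Q')).1

/-- `g` is a zero charge superization with translational supersymmetry. As is part of the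
convention for zero charge, `𝔪` is required to act on `S` through elements of `Cl(𝔪)`. -/
structure Superization.IsZeroChargeTranslational (g : Superization b ρ) : Prop where
  zero_charge : g.adOdd (elP b) = 0
  clifford : ∀ v : Mink E, ∃ c : Cl (mink E), g.adOdd (inMink b v) = spinRep ρ c
  translational : ∀ Q Q' : V × V, ∃ v : Mink E, g.oddBr Q Q' = inMink b v

/-- The quadratic Clifford equation: `(L_{c₁} - R_{c₂})² E ⊆ E`, and the restriction of
`(L_{c₁} - R_{c₂})²` to `E` is `-B`. -/
def QuadraticClifford (b : CWForm E) (c₁ c₂ : Cl (euc E)) : Prop :=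
  (∀ e : E, ((LinearMap.mulLeft ℝ c₁ - LinearMap.mulRight ℝ c₂) ^ 2) (vec _ e) ∈
    LinearMap.range (vec (euc E))) ∧
  ∀ e : E, ((LinearMap.mulLeft ℝ c₁ - LinearMap.mulRight ℝ c₂) ^ 2) (vec _ e) = -vec _ (b.B e)

/-- The data: a solution `(c₁, c₂)` of the quadratic Clifford equation, an element `c₃`, a form
`p_{-+}` in the space spanned by the admissible forms with `τσ = -1`, a symmetric form `p_{++}`,
and the two compatibility conditions. -/
structure SuperizationData (b : CWForm E) (ρ : Cl (euc E) →ₐ[ℝ] Module.End ℝ V)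
    (Sm Sp : Submodule ℝ V) where
  c₁ : Cl (euc E)
  c₂ : Cl (euc E)
  c₃ : Cl (euc E)
  pmp : LinearMap.BilinForm ℝ V
  ppp : LinearMap.BilinForm ℝ V
  quadratic : QuadraticClifford b c₁ c₂
  pmp_mem : pmp ∈ bilTauSigmaNeg ρ Sm Sp
  ppp_symm : ∀ s t, ppp s t = ppp t s
  compat₁ : ∀ s t, pmp (ρ c₃ s) t + pmp (ρ c₃ t) s + ppp (ρ c₂ s) t + ppp s (ρ c₂ t) = 0
  compat₂ : ∀ s t, pmp (ρ c₁ s) t + pmp s (ρ c₂ t) = 0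

/-- The superization `g` is given by the explicit formulas in terms of the data `D`. -/
structure Superization.IsGivenBy {Sm Sp : Submodule ℝ V} (g : Superization b ρ)
    (D : SuperizationData b ρ Sm Sp) : Prop where
  ad_p : g.adOdd (elP b) = 0
  ad_q : g.adOdd (elQ b) = block (ρ D.c₁) (ρ D.c₃) 0 (ρ D.c₂)
  ad_dual : ∀ e : E, g.adOdd (inDual b (flat E e)) = √2 • block 0 (ρ (vec _ (b.B e))) 0 0
  ad_E : ∀ e : E, g.adOdd (inE b e) =
    √2 • block 0 (ρ (vec _ e) ∘ₗ ρ D.c₂ - ρ D.c₁ ∘ₗ ρ (vec _ e)) 0 0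
  odd : ∀ Q : V × V, g.oddBr Q Q = (D.ppp Q.2 Q.2 + 2 * D.pmp Q.1 Q.2) • elP b

end Superization

end CahenWallach

end

/-!
In a zero charge superization everything is determined by `ad_q = (x y; z t)` and by the bracket of
odd elements. The bracket `[e♭, q] = B e` expresses the action of `E` through `ad_q`. Since
`[e♭, f]` is a multiple of `p`, it acts by zero, which forces `z = 0`. Then `[q, e] = e♭` is the
quadratic Clifford equation for `x` and `t`, in `End(S_{0,n-1})`.

To solve it in `Cl(E)` itself, use that `Cl(E)` is simple as a graded algebra. If the representation
is not injective, every element of its image comes from an even element of `Cl(E)`. For even `c₁`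
and `c₂`, both sides of the equation applied to a vector are odd, and an odd element of the kernel
is zero.

As `[S, S]` has no component in `E*`, bracketing with `q` and with `E` shows that `[S, S]` lies in
`ℝ p`. The coefficient of `p` is then an invariant symmetric form on `S`. Its invariance under `E*`
says that it vanishes on `S₋ × S₋` and that `p_{-+}(e s, t)` is skew in `s` and `t`; its invariance
under `q` is the pair of compatibility conditions. Splitting such a `p_{-+}` by its symmetry, and
then by parity with respect to the semi-spinors, writes it as a sum of admissible forms with
`τσ = -1`.
-/

noncomputable section

namespace CahenWallach

open CliffordAlgebra

/-! ### Graded simplicity of Clifford algebras -/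

section Contraction

variable {R M : Type*} [CommRing R] [AddCommGroup M] [Module R M] {Q : QuadraticForm R M}

theorem ι_mul_sub_involute_mul_ι (v : M) (x : CliffordAlgebra Q) :
    ι Q v * x - involute x * ι Q v = contractLeft (Q.polarBilin v) x := by
  induction x using left_induction with
  | algebraMap r => rw [contractLeft_algebraMap, AlgHom.commutes, Algebra.commutes r, sub_self]
  | add x y hx hy => rw [map_add, map_add, ← hx, ← hy]; noncomm_ring
  | ι_mul x m hx =>
    rw [contractLeft_ι_mul, ← hx, Algebra.smul_def, QuadraticMap.polarBilin_apply_apply,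
      ← ι_mul_ι_add_swap, map_mul, involute_ι]
    noncomm_ring

/-- The operator `x ↦ x - v ∧ (d ⌋ x)` of the exterior algebra. When `d v = 1`, it is the
projection onto the kernel of the contraction by `d` that annihilates the multiples of `v`. -/
def eliminate (v : M) (d : Module.Dual R M) : Module.End R (ExteriorAlgebra R M) :=
  1 - LinearMap.mulLeft R (ExteriorAlgebra.ι R v) * contractLeft d

theorem eliminate_apply (v : M) (d : Module.Dual R M) (x : ExteriorAlgebra R M) :
    eliminate v d x = x - ExteriorAlgebra.ι R v * contractLeft d x := rfl

theorem eliminate_ι_mul (v w : M) (d : Module.Dual R M) (x : ExteriorAlgebra R M) :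
    eliminate v d (ExteriorAlgebra.ι R w * x) =
      ExteriorAlgebra.ι R w * eliminate v d x - d w • (ExteriorAlgebra.ι R v * x) := by
  have hvw : ExteriorAlgebra.ι R v * ExteriorAlgebra.ι R w =
      -(ExteriorAlgebra.ι R w * ExteriorAlgebra.ι R v) :=
    eq_neg_of_add_eq_zero_left (ExteriorAlgebra.ι_add_mul_swap v w)
  have hd : contractLeft d (ExteriorAlgebra.ι R w * x) =
      d w • x - ExteriorAlgebra.ι R w * contractLeft d x := contractLeft_ι_mul ..
  rw [eliminate_apply, eliminate_apply, hd, mul_sub, mul_sub, mul_smul_comm, ← mul_assoc,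
    ← mul_assoc, hvw]
  noncomm_ring

/-- The composition of the operators `eliminate` along a list of vectors of a basis. -/
def eliminateAll {κ : Type*} (e : Module.Basis κ R M) (l : List κ) :
    Module.End R (ExteriorAlgebra R M) :=
  (l.map fun i => eliminate (e i) (e.coord i)).prod

theorem eliminateAll_cons_apply {κ : Type*} (e : Module.Basis κ R M) (i : κ) (l : List κ)
    (x : ExteriorAlgebra R M) :
    eliminateAll e (i :: l) x = eliminate (e i) (e.coord i) (eliminateAll e l x) := rfl

theorem eliminateAll_ι_mul {κ : Type*} [DecidableEq κ] (e : Module.Basis κ R M) (l : List κ)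
    (j : κ) (x : ExteriorAlgebra R M) :
    eliminateAll e l (ExteriorAlgebra.ι R (e j) * x) =
      if j ∈ l then 0 else ExteriorAlgebra.ι R (e j) * eliminateAll e l x := by
  induction l with
  | nil => simp [eliminateAll]
  | cons i l ih =>
    rw [eliminateAll_cons_apply, eliminateAll_cons_apply, ih]
    by_cases hjl : j ∈ l
    · simp [hjl]
    · rw [if_neg hjl, eliminate_ι_mul]
      by_cases hij : i = j
      · subst hij
        simp [eliminate_apply, mul_sub, ← mul_assoc]
      · simp [hjl, Ne.symm hij]

theorem eliminateAll_of_contractLeft_eq_zero {κ : Type*} (e : Module.Basis κ R M) (l : List κ)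
    {x : ExteriorAlgebra R M} (hx : ∀ d : Module.Dual R M, contractLeft d x = 0) :
    eliminateAll e l x = x := by
  induction l with
  | nil => rfl
  | cons i l ih => rw [eliminateAll_cons_apply, ih, eliminate_apply, hx, mul_zero, sub_zero]

theorem eliminateAll_mem_range_algebraMap {κ : Type*} [Fintype κ] (e : Module.Basis κ R M)
    (x : ExteriorAlgebra R M) :
    eliminateAll e Finset.univ.toList x ∈ LinearMap.range (Algebra.linearMap R _) := by
  classical
  induction x using left_induction with
  | algebraMap r =>
    rw [eliminateAll_of_contractLeft_eq_zero e _ fun d => contractLeft_algebraMap ..]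
    exact ⟨r, rfl⟩
  | add x y hx hy => exact map_add (eliminateAll e _) x y ▸ add_mem hx hy
  | ι_mul x m =>
    change eliminateAll e _ (ExteriorAlgebra.ι R m * x) ∈ _
    rw [← e.sum_repr m, map_sum, Finset.sum_mul, map_sum]
    refine sum_mem fun i _ => ?_
    rw [map_smul, smul_mul_assoc, map_smul, eliminateAll_ι_mul, if_pos (by simp), smul_zero]
    exact zero_mem _

variable [Module.Finite R M] [Module.Free R M]

theorem exists_algebraMap_eq_of_contractLeft_eq_zero [Invertible (2 : R)] {x : CliffordAlgebra Q}
    (hx : ∀ d : Module.Dual R M, contractLeft d x = 0) : ∃ r, algebraMap R _ r = x := by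
  have hx' (d : Module.Dual R M) : contractLeft d (equivExterior Q x) = 0 := by
    simp [equivExterior, changeFormEquiv, ← changeForm_contractLeft, hx]
  let e := Module.Free.chooseBasis R M
  obtain ⟨r, hr⟩ := eliminateAll_mem_range_algebraMap e (equivExterior Q x)
  rw [eliminateAll_of_contractLeft_eq_zero e _ hx'] at hr
  refine ⟨r, (equivExterior Q).injective ?_⟩
  rw [← hr]
  simp [equivExterior, changeFormEquiv]

end Contraction

section GradedIdeal

variable {K M : Type*} [Field K] [AddCommGroup M] [Module K M] {Q : QuadraticForm K M}

theorem exists_mem_ne_zero_contractLeft_coord_eq_zero {κ : Type*} (e : Module.Basis κ K M)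
    {W : Submodule K (CliffordAlgebra Q)}
    (hW : ∀ (d : Module.Dual K M), ∀ x ∈ W, contractLeft d x ∈ W) (h0 : W ≠ ⊥) (s : Finset κ) :
    ∃ x ∈ W, x ≠ 0 ∧ ∀ i ∈ s, contractLeft (e.coord i) x = 0 := by
  classical
  induction s using Finset.induction with
  | empty => simpa using W.exists_mem_ne_zero_of_ne_bot h0
  | insert i s _ ih =>
    obtain ⟨x, hx, hx0, hxs⟩ := ih
    by_cases hi : contractLeft (e.coord i) x = 0
    · exact ⟨x, hx, hx0, by simpa [hi] using hxs⟩
    · refine ⟨_, hW (e.coord i) x hx, hi, ?_⟩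
      simp only [Finset.forall_mem_insert, contractLeft_contractLeft, true_and]
      intro j hj
      rw [contractLeft_comm, hxs j hj, map_zero, neg_zero]

variable [FiniteDimensional K M] [Invertible (2 : K)]

theorem one_mem_of_contractLeft_mem {W : Submodule K (CliffordAlgebra Q)}
    (hW : ∀ (d : Module.Dual K M), ∀ x ∈ W, contractLeft d x ∈ W) (h0 : W ≠ ⊥) : 1 ∈ W := by
  let e := Module.finBasis K M
  obtain ⟨x, hx, hx0, hxe⟩ := exists_mem_ne_zero_contractLeft_coord_eq_zero e hW h0 .univ
  have hxd (d : Module.Dual K M) : contractLeft d x = 0 := by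
    rw [← e.sum_dual_apply_smul_coord d, map_sum, LinearMap.sum_apply]
    exact Finset.sum_eq_zero fun i hi => by
      rw [map_smul, LinearMap.smul_apply, hxe i hi, smul_zero]
  obtain ⟨r, rfl⟩ := exists_algebraMap_eq_of_contractLeft_eq_zero hxd
  have hr : r ≠ 0 := by rintro rfl; simp at hx0
  simpa [Algebra.algebraMap_eq_smul_one, smul_smul, hr] using W.smul_mem r⁻¹ hx

theorem gradedIdeal_eq_bot_or_eq_top (hQ : LinearMap.BilinForm.Nondegenerate Q.polarBilin)
    {I : TwoSidedIdeal (CliffordAlgebra Q)} (hI : ∀ x ∈ I, involute x ∈ I) : I = ⊥ ∨ I = ⊤ := by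
  let W : Submodule K (CliffordAlgebra Q) := I.asIdeal.restrictScalars K
  have hW (d : Module.Dual K M) (x) (hx : x ∈ W) : contractLeft d x ∈ W := by
    obtain ⟨v, rfl⟩ := (LinearMap.BilinForm.toDual _ hQ).surjective d
    change contractLeft (Q.polarBilin v) x ∈ I
    rw [← ι_mul_sub_involute_mul_ι]
    exact I.sub_mem (I.mul_mem_left _ _ hx) (I.mul_mem_right _ _ (hI x hx))
  by_cases h0 : W = ⊥
  · refine .inl (TwoSidedIdeal.ext fun x => ?_)
    rw [TwoSidedIdeal.mem_bot, ← Submodule.mem_bot K, ← h0]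
    rfl
  · exact .inr ((TwoSidedIdeal.one_mem_iff I).mp (one_mem_of_contractLeft_mem hW h0))

end GradedIdeal

section LeftSubRight

/-- The operator `L_{c₁} - R_{c₂}` of the quadratic Clifford equation, in an arbitrary algebra. -/
def leftSubRight (R : Type*) {A : Type*} [CommRing R] [Ring A] [Algebra R A] (c₁ c₂ : A) :
    Module.End R A :=
  LinearMap.mulLeft R c₁ - LinearMap.mulRight R c₂

variable {R A A' : Type*} [CommRing R] [Ring A] [Algebra R A] [Ring A'] [Algebra R A']

theorem leftSubRight_apply (c₁ c₂ x : A) : leftSubRight R c₁ c₂ x = c₁ * x - x * c₂ := rfl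

theorem map_leftSubRight_pow (φ : A →ₐ[R] A') (c₁ c₂ x : A) (n : ℕ) :
    φ ((leftSubRight R c₁ c₂ ^ n) x) = (leftSubRight R (φ c₁) (φ c₂) ^ n) (φ x) := by
  induction n with
  | zero => rfl
  | succ n ih =>
    rw [pow_succ', pow_succ', Module.End.mul_apply, Module.End.mul_apply, leftSubRight_apply,
      leftSubRight_apply, map_sub, map_mul, map_mul, ih]

end LeftSubRight

section Representation

variable {K M A : Type*} [Field K] [AddCommGroup M] [Module K M] [FiniteDimensional K M]
  [Invertible (2 : K)] {Q : QuadraticForm K M} [Ring A] [Algebra K A]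

theorem eq_zero_of_map_eq_zero_of_map_involute_eq_zero [Nontrivial A]
    (hQ : LinearMap.BilinForm.Nondegenerate Q.polarBilin) (φ : CliffordAlgebra Q →ₐ[K] A)
    {x : CliffordAlgebra Q} (hx : φ x = 0) (hx' : φ (involute x) = 0) : x = 0 := by
  let J := TwoSidedIdeal.ker φ
  let I := J ⊓ J.comap involute
  have mem_I {y} : y ∈ I ↔ φ y = 0 ∧ φ (involute y) = 0 := by
    simp only [I, J, TwoSidedIdeal.mem_inf, TwoSidedIdeal.mem_comap, TwoSidedIdeal.mem_ker]
  have hI : I = ⊥ := by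
    refine (gradedIdeal_eq_bot_or_eq_top hQ fun y hy => ?_).resolve_right fun h => ?_
    · rw [mem_I, involute_involute]
      exact (mem_I.mp hy).symm
    · exact one_ne_zero ((map_one φ).symm.trans (mem_I.mp ((I.one_mem_iff).mpr h)).1)
  rw [← TwoSidedIdeal.mem_bot, ← hI]
  exact mem_I.mpr ⟨hx, hx'⟩

theorem injective_or_exists_even_lift (hQ : LinearMap.BilinForm.Nondegenerate Q.polarBilin)
    (φ : CliffordAlgebra Q →ₐ[K] A) :
    Function.Injective φ ∨ ∀ c, ∃ d, involute d = d ∧ φ d = φ c := by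
  let J := TwoSidedIdeal.ker φ
  let I := J ⊔ J.comap involute
  have mem_J {x} : x ∈ J ↔ φ x = 0 := TwoSidedIdeal.mem_ker φ
  have mem_comap {x} : x ∈ J.comap involute ↔ φ (involute x) = 0 := by
    rw [TwoSidedIdeal.mem_comap, mem_J]
  have hI : ∀ x ∈ I, involute x ∈ I := by
    intro x hx
    obtain ⟨j, hj, k, hk, rfl⟩ := TwoSidedIdeal.mem_sup.mp hx
    rw [map_add]
    refine I.add_mem (TwoSidedIdeal.mem_sup_right ?_) (TwoSidedIdeal.mem_sup_left ?_)
    · rwa [mem_comap, involute_involute, ← mem_J]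
    · rwa [mem_J, ← mem_comap]
  rcases gradedIdeal_eq_bot_or_eq_top hQ hI with h | h
  · refine .inl ((injective_iff_map_eq_zero φ).mpr fun x hx => ?_)
    rw [← TwoSidedIdeal.mem_bot, ← h]
    exact TwoSidedIdeal.mem_sup_left (mem_J.mpr hx)
  · obtain ⟨j, hj, k, hk, hjk⟩ := TwoSidedIdeal.mem_sup.mp ((I.one_mem_iff).mpr h)
    rw [mem_J] at hj
    rw [mem_comap] at hk
    have hφk : φ k = 1 := by rw [← map_one φ, ← hjk, map_add, hj, zero_add]
    refine .inr fun c => ⟨c * k + involute (c * k), ?_, ?_⟩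
    · rw [map_add, involute_involute, add_comm]
    · rw [map_add, map_mul, map_mul involute, map_mul, hφk, hk, mul_zero, mul_one, add_zero]

/- If `φ` is not injective, `c₁` and `c₂` can be chosen even. Then both sides of the equation are
odd, and the kernel of `φ` contains no odd elements other than zero. -/
theorem exists_leftSubRight_pow_lift [Nontrivial A]
    (hQ : LinearMap.BilinForm.Nondegenerate Q.polarBilin) (φ : CliffordAlgebra Q →ₐ[K] A)
    (f : M → M) (n : ℕ) (c₁ c₂ : CliffordAlgebra Q)
    (h : ∀ v, (leftSubRight K (φ c₁) (φ c₂) ^ n) (φ (ι Q v)) = φ (ι Q (f v))) :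
    ∃ d₁ d₂, φ d₁ = φ c₁ ∧ φ d₂ = φ c₂ ∧
      ∀ v, (leftSubRight K d₁ d₂ ^ n) (ι Q v) = ι Q (f v) := by
  rcases injective_or_exists_even_lift hQ φ with hφ | hlift
  · exact ⟨c₁, c₂, rfl, rfl, fun v => hφ (by rw [map_leftSubRight_pow, h])⟩
  · obtain ⟨d₁, hd₁, h₁⟩ := hlift c₁
    obtain ⟨d₂, hd₂, h₂⟩ := hlift c₂
    refine ⟨d₁, d₂, h₁, h₂, fun v => ?_⟩
    have hφ : φ ((leftSubRight K d₁ d₂ ^ n) (ι Q v)) = φ (ι Q (f v)) := by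
      rw [map_leftSubRight_pow, h₁, h₂, h]
    have hodd : involute ((leftSubRight K d₁ d₂ ^ n) (ι Q v)) =
        -(leftSubRight K d₁ d₂ ^ n) (ι Q v) := by
      rw [map_leftSubRight_pow, hd₁, hd₂, involute_ι, map_neg]
    rw [← sub_eq_zero]
    refine eq_zero_of_map_eq_zero_of_map_involute_eq_zero hQ φ ?_ ?_
    · rw [map_sub, hφ, sub_self]
    · rw [map_sub, hodd, involute_ι, map_sub, map_neg, map_neg, hφ, sub_self]

end Representation

section Euclidean

variable {E : Type*} [NormedAddCommGroup E] [InnerProductSpace ℝ E]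

theorem vec_mul_self (e : E) :
    vec (euc E) e * vec (euc E) e = algebraMap ℝ _ (inner ℝ e e) := by
  rw [ι_sq_scalar, clForm_apply, euc_apply, neg_neg]

theorem nondegenerate_polarBilin_clForm_euc :
    LinearMap.BilinForm.Nondegenerate (clForm (euc E)).polarBilin := by
  refine ⟨fun e he => ?_, fun e he => ?_⟩
  all_goals
    have h := he e
    rwa [QuadraticMap.polarBilin_apply_apply, QuadraticMap.polar_self, clForm_apply, euc_apply,
      neg_neg, two_nsmul, add_self_eq_zero, inner_self_eq_zero] at h

theorem quadraticClifford_iff [FiniteDimensional ℝ E] {b : CWForm E} {c₁ c₂ : Cl (euc E)} :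
    QuadraticClifford b c₁ c₂ ↔
      ∀ e : E, (leftSubRight ℝ c₁ c₂ ^ 2) (vec _ e) = -vec _ (b.B e) :=
  ⟨And.right, fun h => ⟨fun e => ⟨-b.B e, ((h e).trans (map_neg _ _).symm).symm⟩, h⟩⟩

theorem exists_quadraticClifford_lift [FiniteDimensional ℝ E] {A : Type*} [Ring A] [Algebra ℝ A]
    [Nontrivial A] (b : CWForm E) (φ : Cl (euc E) →ₐ[ℝ] A) (c₁ c₂ : Cl (euc E))
    (h : ∀ e, (leftSubRight ℝ (φ c₁) (φ c₂) ^ 2) (φ (vec _ e)) = -φ (vec _ (b.B e))) :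
    ∃ d₁ d₂, φ d₁ = φ c₁ ∧ φ d₂ = φ c₂ ∧ QuadraticClifford b d₁ d₂ := by
  obtain ⟨d₁, d₂, h₁, h₂, hd⟩ := exists_leftSubRight_pow_lift nondegenerate_polarBilin_clForm_euc φ
    (fun e => -b.B e) 2 c₁ c₂ fun e => by rw [h, map_neg, map_neg]
  exact ⟨d₁, d₂, h₁, h₂, quadraticClifford_iff.mpr fun e => by rw [hd, map_neg]⟩

end Euclidean

/-! ### The forms spanned by the admissible ones with `τσ = -1` -/

section ComplementInvolution

variable {R V : Type*} [CommRing R] [AddCommGroup V] [Module R V] {p q : Submodule R V}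

/-- The involution equal to `1` on `p` and to `-1` on the complement `q`. -/
def complInvolution (h : IsCompl p q) : Module.End R V :=
  LinearMap.ofIsCompl h p.subtype (-q.subtype)

theorem complInvolution_of_mem_left (h : IsCompl p q) {s : V} (hs : s ∈ p) :
    complInvolution h s = s :=
  LinearMap.ofIsCompl_apply_left h ⟨s, hs⟩

theorem complInvolution_of_mem_right (h : IsCompl p q) {s : V} (hs : s ∈ q) :
    complInvolution h s = -s :=
  LinearMap.ofIsCompl_apply_right h ⟨s, hs⟩

theorem complInvolution_anticomm (h : IsCompl p q) {f : Module.End R V} (hp : ∀ s ∈ p, f s ∈ q)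
    (hq : ∀ s ∈ q, f s ∈ p) (s : V) : complInvolution h (f s) = -f (complInvolution h s) := by
  obtain ⟨a, ha, c, hc, rfl⟩ := Submodule.mem_sup.mp (h.sup_eq_top ▸ Submodule.mem_top (x := s))
  simp only [map_add, map_neg, complInvolution_of_mem_left h ha,
    complInvolution_of_mem_right h hc, complInvolution_of_mem_left h (hq c hc),
    complInvolution_of_mem_right h (hp a ha), neg_add, neg_neg]

end ComplementInvolution

section Forms

variable {E : Type*} [NormedAddCommGroup E] [InnerProductSpace ℝ E]
  {V : Type*} [AddCommGroup V] [Module ℝ V]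

theorem vec_vec_apply (ρ : Cl (euc E) →ₐ[ℝ] Module.End ℝ V) (e : E) (s : V) :
    ρ (vec _ e) (ρ (vec _ e) s) = (inner ℝ e e : ℝ) • s := by
  rw [← Module.End.mul_apply, ← map_mul, vec_mul_self, AlgHom.commutes]
  rfl

variable {ρ : Cl (euc E) →ₐ[ℝ] Module.End ℝ V}

theorem eq_zero_of_vec_apply_eq_zero {e : E} (he : e ≠ 0) {s : V} (h : ρ (vec _ e) s = 0) :
    s = 0 := by
  have hs := vec_vec_apply ρ e s
  rw [h, map_zero] at hs
  exact (smul_eq_zero.mp hs.symm).resolve_left (inner_self_ne_zero.mpr he)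

/-- `V = S⁻ + S⁺` is a grading of the Clifford module `V`: a semi-spinor decomposition without the
irreducibility of its summands. -/
structure IsCliffordGrading (ρ : Cl (euc E) →ₐ[ℝ] Module.End ℝ V) (Sm Sp : Submodule ℝ V) :
    Prop where
  compl : IsCompl Sm Sp
  odd_minus : ∀ v : E, ∀ s ∈ Sm, ρ (vec _ v) s ∈ Sp
  odd_plus : ∀ v : E, ∀ s ∈ Sp, ρ (vec _ v) s ∈ Sm

theorem IsSemispinorSplitting.isCliffordGrading {Sm Sp : Submodule ℝ V}
    (h : IsSemispinorSplitting ρ Sm Sp) : IsCliffordGrading ρ Sm Sp :=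
  ⟨h.compl, h.odd_minus, h.odd_plus⟩

variable (ρ) in
/-- The forms of type `τ` and symmetry `σ`: admissible forms without the isotropy condition. -/
def formsOfType (τ σ : ℤˣ) : Submodule ℝ (LinearMap.BilinForm ℝ V) where
  carrier := {Γ | (∀ (v : E) (s t : V), Γ (ρ (vec _ v) s) t = (τ : ℤ) * Γ s (ρ (vec _ v) t)) ∧
    ∀ s t : V, Γ s t = (σ : ℤ) * Γ t s}
  zero_mem' := by simp
  add_mem' := fun {Γ Γ'} hΓ hΓ' => by
    refine ⟨fun v s t => ?_, fun s t => ?_⟩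
    · rw [LinearMap.add_apply, LinearMap.add_apply, hΓ.1, hΓ'.1]
      exact (mul_add ..).symm
    · rw [LinearMap.add_apply, LinearMap.add_apply, hΓ.2, hΓ'.2]
      exact (mul_add ..).symm
  smul_mem' := fun r Γ hΓ => by
    refine ⟨fun v s t => ?_, fun s t => ?_⟩
    · rw [LinearMap.smul_apply, LinearMap.smul_apply, hΓ.1]
      exact mul_left_comm ..
    · rw [LinearMap.smul_apply, LinearMap.smul_apply, hΓ.2]
      exact mul_left_comm ..

theorem soCl_invariant_of_mem_formsOfType {τ σ : ℤˣ} {Γ : LinearMap.BilinForm ℝ V}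
    (hΓ : Γ ∈ formsOfType ρ τ σ) (v w : E) (s t : V) :
    Γ (ρ (soCl (euc E) v w) s) t + Γ s (ρ (soCl (euc E) v w) t) = 0 := by
  have hτ : (((τ : ℤ) : ℝ)) * ((τ : ℤ) : ℝ) = 1 := by
    rw [← Int.cast_mul, Int.units_coe_mul_self, Int.cast_one]
  have hmul (v w : E) :
      Γ (ρ (vec _ v) (ρ (vec _ w) s)) t = Γ s (ρ (vec _ w) (ρ (vec _ v) t)) := by
    rw [hΓ.1, hΓ.1, ← mul_assoc, hτ, one_mul]
  simp only [soCl, map_smul, map_sub, map_mul, LinearMap.smul_apply, LinearMap.sub_apply,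
    Module.End.mul_apply, hmul, smul_eq_mul]
  ring

theorem compl₁₂_complInvolution_mem_formsOfType {Sm Sp : Submodule ℝ V}
    (h : IsCliffordGrading ρ Sm Sp) {τ σ : ℤˣ} {Γ : LinearMap.BilinForm ℝ V}
    (hΓ : Γ ∈ formsOfType ρ τ σ) :
    Γ.compl₁₂ (complInvolution h.compl) (complInvolution h.compl) ∈ formsOfType ρ τ σ := by
  refine ⟨fun v s t => ?_, fun s t => hΓ.2 _ _⟩
  have hanti (s : V) := complInvolution_anticomm h.compl (h.odd_minus v) (h.odd_plus v) s
  rw [LinearMap.compl₁₂_apply, LinearMap.compl₁₂_apply, hanti, hanti, map_neg, map_neg,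
    LinearMap.neg_apply, hΓ.1, mul_neg]

/- With `ε` the involution of the grading, `Γ + Γ(ε ·, ε ·)` makes the two summands orthogonal, and
`Γ - Γ(ε ·, ε ·)` makes them isotropic. -/
theorem formsOfType_le_bilTauSigmaNeg {Sm Sp : Submodule ℝ V}
    (hS : ¬ SoIrreducible ρ (⊤ : Submodule ℝ V) → IsCliffordGrading ρ Sm Sp) {τ σ : ℤˣ}
    (hτσ : τ * σ = -1) : formsOfType ρ τ σ ≤ bilTauSigmaNeg ρ Sm Sp := by
  intro Γ hΓ
  by_cases hirr : SoIrreducible ρ (⊤ : Submodule ℝ V)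
  · exact Submodule.subset_span ⟨τ, σ, hτσ, soCl_invariant_of_mem_formsOfType hΓ, hΓ.1, hΓ.2,
      fun h => absurd hirr h⟩
  have h := hS hirr
  have hm {s} (hs : s ∈ Sm) := complInvolution_of_mem_left h.compl hs
  have hp {s} (hs : s ∈ Sp) := complInvolution_of_mem_right h.compl hs
  let Γ' : LinearMap.BilinForm ℝ V :=
    Γ.compl₁₂ (complInvolution h.compl) (complInvolution h.compl)
  have hΓ' : Γ' ∈ formsOfType ρ τ σ := compl₁₂_complInvolution_mem_formsOfType h hΓ
  have hadd : Γ + Γ' ∈ formsOfType ρ τ σ := add_mem hΓ hΓ'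
  have hsub : Γ + (-1 : ℝ) • Γ' ∈ formsOfType ρ τ σ := add_mem hΓ (Submodule.smul_mem _ _ hΓ')
  have hsum : Γ = (1 / 2 : ℝ) • (Γ + Γ') + (1 / 2 : ℝ) • (Γ + (-1 : ℝ) • Γ') := by module
  rw [hsum]
  refine add_mem (Submodule.smul_mem _ _ (Submodule.subset_span ⟨τ, σ, hτσ,
      soCl_invariant_of_mem_formsOfType hadd, hadd.1, hadd.2, fun _ => .inl ?_⟩))
    (Submodule.smul_mem _ _ (Submodule.subset_span ⟨τ, σ, hτσ,
      soCl_invariant_of_mem_formsOfType hsub, hsub.1, hsub.2, fun _ => .inr ⟨?_, ?_⟩⟩))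
  · exact fun s hs t ht => by simp [Γ', hm hs, hp ht]
  · exact fun s hs t ht => by simp [Γ', hm hs, hm ht]
  · exact fun s hs t ht => by simp [Γ', hp hs, hp ht]

variable (ρ) in
/-- The forms with `Γ(v s, t) = -Γ(v t, s)` for the vectors `v` of `E`. -/
def vecSkewForms : Submodule ℝ (LinearMap.BilinForm ℝ V) where
  carrier := {Γ | ∀ (v : E) (s t : V), Γ (ρ (vec _ v) s) t = -Γ (ρ (vec _ v) t) s}
  zero_mem' := by simp
  add_mem' hΓ hΓ' v s t := by
    rw [LinearMap.add_apply, LinearMap.add_apply, hΓ, hΓ']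
    exact (neg_add ..).symm
  smul_mem' r Γ hΓ v s t := by
    rw [LinearMap.smul_apply, LinearMap.smul_apply, hΓ]
    exact smul_neg ..

theorem mem_vecSkewForms {Γ : LinearMap.BilinForm ℝ V} :
    Γ ∈ vecSkewForms ρ ↔
      ∀ (v : E) (s t : V), Γ (ρ (vec _ v) s) t = -Γ (ρ (vec _ v) t) s := Iff.rfl

theorem apply_vec_of_mem_vecSkewForms {Γ : LinearMap.BilinForm ℝ V} (hΓ : Γ ∈ vecSkewForms ρ)
    (v : E) (s t : V) : Γ s (ρ (vec _ v) t) = -Γ t (ρ (vec _ v) s) := by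
  by_cases hv : v = 0
  · simp [hv]
  have hvv : (inner ℝ v v : ℝ) ≠ 0 := inner_self_ne_zero.mpr hv
  have h := hΓ v (ρ (vec _ v) s) (ρ (vec _ v) t)
  rw [vec_vec_apply, vec_vec_apply] at h
  simp only [map_smul, LinearMap.smul_apply, smul_eq_mul, ← mul_neg] at h
  exact mul_left_cancel₀ hvv h

theorem bilTauSigmaNeg_le_vecSkewForms {Sm Sp : Submodule ℝ V} :
    bilTauSigmaNeg ρ Sm Sp ≤ vecSkewForms ρ := by
  refine Submodule.span_le.mpr ?_
  rintro Γ ⟨τ, σ, hτσ, hΓ⟩ v s t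
  rw [hΓ.type, hΓ.symmetry, ← mul_assoc, ← Int.cast_mul, ← Units.val_mul, hτσ]
  simp

theorem bilTauSigmaNeg_eq_vecSkewForms {Sm Sp : Submodule ℝ V}
    (hS : ¬ SoIrreducible ρ (⊤ : Submodule ℝ V) → IsCliffordGrading ρ Sm Sp) :
    bilTauSigmaNeg ρ Sm Sp = vecSkewForms ρ := by
  refine le_antisymm bilTauSigmaNeg_le_vecSkewForms fun Γ hΓ => ?_
  have hsym : Γ + LinearMap.flip Γ ∈ formsOfType ρ (-1) 1 := by
    refine ⟨fun v s t => ?_, fun s t => ?_⟩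
    · simp [hΓ v s t, apply_vec_of_mem_vecSkewForms hΓ v t s]
    · simp [add_comm]
  have hskew : Γ - LinearMap.flip Γ ∈ formsOfType ρ 1 (-1) := by
    refine ⟨fun v s t => ?_, fun s t => ?_⟩
    · simp only [LinearMap.sub_apply, LinearMap.flip_apply, hΓ v s t,
        apply_vec_of_mem_vecSkewForms hΓ v t s, Units.val_one, Int.cast_one]
      ring
    · simp
  have hsum : Γ = (1 / 2 : ℝ) • (Γ + LinearMap.flip Γ) + (1 / 2 : ℝ) • (Γ - LinearMap.flip Γ) := by
    module
  rw [hsum]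
  exact add_mem (Submodule.smul_mem _ _ (formsOfType_le_bilTauSigmaNeg hS (by simp) hsym))
    (Submodule.smul_mem _ _ (formsOfType_le_bilTauSigmaNeg hS (by simp) hskew))

end Forms

/-! ### The image of the spin representation of `Cl(𝔪)` -/

section Blocks

variable {V : Type*} [AddCommGroup V] [Module ℝ V]

theorem block_mul (x y z t x' y' z' t' : Module.End ℝ V) :
    block x y z t * block x' y' z' t' =
      block (x * x' + y * z') (x * y' + y * t') (z * x' + t * z') (z * y' + t * t') := by
  refine LinearMap.ext fun Q => Prod.ext ?_ ?_ <;>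
    simp only [Module.End.mul_apply, block_apply, map_add, LinearMap.add_apply] <;> abel

theorem block_add (x y z t x' y' z' t' : Module.End ℝ V) :
    block x y z t + block x' y' z' t' = block (x + x') (y + y') (z + z') (t + t') := by
  refine LinearMap.ext fun Q => Prod.ext ?_ ?_ <;>
    simp only [block_apply, LinearMap.add_apply, Prod.fst_add, Prod.snd_add] <;> abel

theorem block_sub (x y z t x' y' z' t' : Module.End ℝ V) :
    block x y z t - block x' y' z' t' = block (x - x') (y - y') (z - z') (t - t') := by
  refine LinearMap.ext fun Q => Prod.ext ?_ ?_ <;>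
    simp only [block_apply, LinearMap.sub_apply, Prod.fst_sub, Prod.snd_sub] <;> abel

theorem smul_block (r : ℝ) (x y z t : Module.End ℝ V) :
    r • block x y z t = block (r • x) (r • y) (r • z) (r • t) := by
  refine LinearMap.ext fun Q => Prod.ext ?_ ?_ <;>
    simp only [block_apply, LinearMap.smul_apply, Prod.smul_fst, Prod.smul_snd, smul_add]

theorem algebraMap_eq_block (r : ℝ) :
    algebraMap ℝ (Module.End ℝ (V × V)) r = block (algebraMap ℝ _ r) 0 0 (algebraMap ℝ _ r) := by
  refine LinearMap.ext fun Q => Prod.ext ?_ ?_ <;> simp [block_apply]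

theorem block_inj {x y z t x' y' z' t' : Module.End ℝ V} :
    block x y z t = block x' y' z' t' ↔ x = x' ∧ y = y' ∧ z = z' ∧ t = t' := by
  refine ⟨fun h => ?_, by rintro ⟨rfl, rfl, rfl, rfl⟩; rfl⟩
  have hleft (s : V) := LinearMap.congr_fun h (s, 0)
  have hright (s : V) := LinearMap.congr_fun h (0, s)
  simp only [block_apply, map_zero, add_zero, zero_add, Prod.mk.injEq] at hleft hright
  exact ⟨LinearMap.ext fun s => (hleft s).1, LinearMap.ext fun s => (hright s).1,
    LinearMap.ext fun s => (hleft s).2, LinearMap.ext fun s => (hright s).2⟩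

variable {E : Type*} [NormedAddCommGroup E] [InnerProductSpace ℝ E]
  (ρ : Cl (euc E) →ₐ[ℝ] Module.End ℝ V)

theorem spinRep_vec (v : Mink E) :
    spinRep ρ (vec (mink E) v) = block (-ρ (vec _ v.1)) ((2 * √2 * v.2.1) • 1)
      ((-(1 / √2) * v.2.2) • 1) (ρ (vec _ v.1)) :=
  lift_ι_apply ..

theorem exists_spinRep_eq_block (c : Cl (mink E)) :
    ∃ x y z t, spinRep ρ c = block (ρ x) (ρ y) (ρ z) (ρ t) := by
  induction c using CliffordAlgebra.induction with
  | algebraMap r =>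
    refine ⟨algebraMap ℝ _ r, 0, 0, algebraMap ℝ _ r, ?_⟩
    rw [AlgHom.commutes, AlgHom.commutes, map_zero, algebraMap_eq_block]
  | ι v =>
    refine ⟨-vec _ v.1, (2 * √2 * v.2.1) • 1, (-(1 / √2) * v.2.2) • 1, vec _ v.1, ?_⟩
    rw [spinRep_vec, map_neg, map_smul, map_smul, map_one]
  | mul a c ha hc =>
    obtain ⟨x, y, z, t, h⟩ := ha
    obtain ⟨x', y', z', t', h'⟩ := hc
    refine ⟨x * x' + y * z', x * y' + y * t', z * x' + t * z', z * y' + t * t', ?_⟩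
    rw [map_mul, h, h', block_mul]
    simp only [map_add, map_mul]
  | add a c ha hc =>
    obtain ⟨x, y, z, t, h⟩ := ha
    obtain ⟨x', y', z', t', h'⟩ := hc
    refine ⟨x + x', y + y', z + z', t + t', ?_⟩
    rw [map_add, h, h', block_add]
    simp only [map_add]

theorem block_upperRight_one_mem_range_spinRep : block 0 1 0 0 ∈ (spinRep ρ).range := by
  refine ⟨(2 * √2)⁻¹ • vec _ (0, 1, 0), ?_⟩
  change spinRep ρ _ = _
  have hcancel : (2 * √2)⁻¹ * (2 * √2) = 1 := inv_mul_cancel₀ (by positivity)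
  rw [map_smul, spinRep_vec, smul_block, mul_one, smul_smul, hcancel]
  simp

theorem block_lowerLeft_one_mem_range_spinRep : block 0 0 1 0 ∈ (spinRep ρ).range := by
  refine ⟨-√2 • vec _ (0, 0, 1), ?_⟩
  change spinRep ρ _ = _
  rw [map_smul, spinRep_vec, smul_block]
  simp [smul_smul]

theorem block_upperLeft_mem_range_spinRep (c : Cl (euc E)) :
    block (ρ c) 0 0 0 ∈ (spinRep ρ).range := by
  have hone : block 1 0 0 0 ∈ (spinRep ρ).range := by
    simpa [block_mul] using mul_mem (block_upperRight_one_mem_range_spinRep ρ)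
      (block_lowerLeft_one_mem_range_spinRep ρ)
  induction c using CliffordAlgebra.induction with
  | algebraMap r =>
    simpa [smul_block, Algebra.algebraMap_eq_smul_one] using Subalgebra.smul_mem _ hone r
  | ι v =>
    have hv : spinRep ρ (vec _ (-v, 0, 0)) ∈ (spinRep ρ).range := ⟨_, rfl⟩
    simpa [spinRep_vec, block_mul] using mul_mem hv hone
  | mul a c ha hc => simpa [block_mul] using mul_mem ha hc
  | add a c ha hc => simpa [block_add] using add_mem ha hc

theorem block_mem_range_spinRep (x y z t : Cl (euc E)) :
    block (ρ x) (ρ y) (ρ z) (ρ t) ∈ (spinRep ρ).range := by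
  have hsum : block (ρ x) (ρ y) (ρ z) (ρ t) =
      block (ρ x) 0 0 0 + block (ρ y) 0 0 0 * block 0 1 0 0 + block 0 0 1 0 * block (ρ z) 0 0 0 +
        block 0 0 1 0 * block (ρ t) 0 0 0 * block 0 1 0 0 := by
    simp [block_mul, block_add]
  have hul := block_upperLeft_mem_range_spinRep ρ
  have hur := block_upperRight_one_mem_range_spinRep ρ
  have hll := block_lowerLeft_one_mem_range_spinRep ρ
  rw [hsum]
  exact add_mem (add_mem (add_mem (hul x) (mul_mem (hul y) hur)) (mul_mem hll (hul z)))
    (mul_mem (mul_mem hll (hul t)) hur)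

theorem isotropySpin_eq_block [FiniteDimensional ℝ E] (b : CWForm E) (ξ : Module.Dual ℝ E) :
    isotropySpin b ρ ξ = √2 • block 0 (ρ (vec _ (b.B ((flat E).symm ξ)))) 0 0 := by
  rw [isotropySpin, soCl, map_smul, map_sub, map_mul, map_mul, spinRep_vec, spinRep_vec,
    block_mul, block_mul, block_sub, smul_block, smul_block, block_inj]
  refine ⟨by simp, ?_, by simp, by simp⟩
  simp only [map_zero, mul_one, mul_zero, zero_smul, smul_mul_assoc, one_mul, add_zero,
    mul_smul_comm, neg_zero, zero_add]
  module

end Blocks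

/-! ### Lie superalgebras and representations of their even part -/

section LieSuperalgebra

variable {A₀ A₁ : Type*}

section Parity

variable [AddCommGroup A₀] [Module ℝ A₀] [AddCommGroup A₁] [Module ℝ A₁]

theorem mem_parityPart_zero {x : A₀ × A₁} : x ∈ parityPart A₀ A₁ 0 ↔ x.2 = 0 := by
  obtain ⟨x, Q⟩ := x
  simp [parityPart, eq_comm]

theorem mem_parityPart_one {x : A₀ × A₁} : x ∈ parityPart A₀ A₁ 1 ↔ x.1 = 0 := by
  obtain ⟨x, Q⟩ := x
  simp [parityPart, eq_comm]

theorem mk_zero_mem_parityPart_zero (x : A₀) : (x, 0) ∈ parityPart A₀ A₁ 0 :=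
  mem_parityPart_zero.mpr rfl

theorem zero_mk_mem_parityPart_one (Q : A₁) : (0, Q) ∈ parityPart A₀ A₁ 1 :=
  mem_parityPart_one.mpr rfl

theorem parity_cases {p : ZMod 2 → Prop} (even : p 0) (odd : p 1) (i : ZMod 2) : p i := by
  fin_cases i
  exacts [even, odd]

namespace LieSuperalgebraOn

variable (L : LieSuperalgebraOn A₀ A₁)

theorem br_injective : Function.Injective (br : LieSuperalgebraOn A₀ A₁ → _) := by
  rintro ⟨_, _, _, _⟩ ⟨_, _, _, _⟩ rfl
  rfl

/-- The adjoint action of the even part on the odd part. -/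
def act : A₀ →ₗ[ℝ] Module.End ℝ A₁ :=
  (L.br.compl₁₂ (LinearMap.inl ℝ A₀ A₁) (LinearMap.inr ℝ A₀ A₁)).compr₂ (LinearMap.snd ℝ A₀ A₁)

/-- The bracket of odd elements. -/
def oddBracket : A₁ →ₗ[ℝ] A₁ →ₗ[ℝ] A₀ :=
  (L.br.compl₁₂ (LinearMap.inr ℝ A₀ A₁) (LinearMap.inr ℝ A₀ A₁)).compr₂ (LinearMap.fst ℝ A₀ A₁)

theorem br_even_odd (x : A₀) (Q : A₁) : L.br (x, 0) (0, Q) = (0, L.act x Q) := by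
  have h := L.graded 0 1 _ (mk_zero_mem_parityPart_zero x) _ (zero_mk_mem_parityPart_one Q)
  rw [zero_add, mem_parityPart_one] at h
  exact Prod.ext h rfl

theorem br_odd_even (x : A₀) (Q : A₁) : L.br (0, Q) (x, 0) = (0, -L.act x Q) := by
  rw [L.skew 1 0 _ (zero_mk_mem_parityPart_one Q) _ (mk_zero_mem_parityPart_zero x), br_even_odd]
  simp

theorem br_odd_odd (Q R : A₁) : L.br (0, Q) (0, R) = (L.oddBracket Q R, 0) := by
  have h := L.graded 1 1 _ (zero_mk_mem_parityPart_one Q) _ (zero_mk_mem_parityPart_one R)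
  rw [show (1 : ZMod 2) + 1 = 0 from rfl, mem_parityPart_zero] at h
  exact Prod.ext rfl h

theorem oddBracket_comm (Q R : A₁) : L.oddBracket Q R = L.oddBracket R Q := by
  have h := L.skew 1 1 _ (zero_mk_mem_parityPart_one Q) _ (zero_mk_mem_parityPart_one R)
  rw [br_odd_odd, br_odd_odd] at h
  simpa [ZMod.val_one] using h

theorem oddBracket_polarize (Q R : A₁) : L.oddBracket Q R = (1 / 2 : ℝ) •
    (L.oddBracket (Q + R) (Q + R) - L.oddBracket Q Q - L.oddBracket R R) := by
  rw [map_add, map_add, LinearMap.add_apply, LinearMap.add_apply, L.oddBracket_comm R Q]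
  module

end LieSuperalgebraOn

end Parity

variable [LieRing A₀] [LieAlgebra ℝ A₀] [AddCommGroup A₁] [Module ℝ A₁]

namespace LieSuperalgebraOn

section EvenPart

variable {L : LieSuperalgebraOn A₀ A₁} (heven : ∀ x y : A₀, L.br (x, 0) (y, 0) = (⁅x, y⁆, 0))

include heven

theorem br_mk (x y : A₀) (Q R : A₁) :
    L.br (x, Q) (y, R) = (⁅x, y⁆ + L.oddBracket Q R, L.act x R - L.act y Q) := by
  have hsplit (z : A₀) (T : A₁) : (z, T) = (z, 0) + (0, T) := by simp
  rw [hsplit x Q, hsplit y R, map_add, map_add, LinearMap.add_apply, LinearMap.add_apply, heven,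
    br_even_odd, br_odd_even, br_odd_odd]
  refine Prod.ext ?_ ?_ <;> simp [sub_eq_add_neg, add_comm]

theorem act_lie (x y : A₀) : L.act ⁅x, y⁆ = L.act x * L.act y - L.act y * L.act x := by
  refine LinearMap.ext fun Q => ?_
  have h := congrArg Prod.snd (L.jacobi 0 0 _ (mk_zero_mem_parityPart_zero x) _
    (mk_zero_mem_parityPart_zero y) (0, Q))
  simp only [br_even_odd, heven, ZMod.val_zero, mul_zero, pow_zero, one_smul, Prod.snd_add] at h
  rw [LinearMap.sub_apply, Module.End.mul_apply, Module.End.mul_apply, h,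
    add_sub_cancel_right]

theorem lie_oddBracket (x : A₀) (Q R : A₁) :
    ⁅x, L.oddBracket Q R⁆ = L.oddBracket (L.act x Q) R + L.oddBracket Q (L.act x R) := by
  have h := L.jacobi 0 1 _ (mk_zero_mem_parityPart_zero x) _ (zero_mk_mem_parityPart_one Q) (0, R)
  rw [br_odd_odd, br_even_odd, heven, br_even_odd, br_odd_odd, br_odd_odd] at h
  simpa using congrArg Prod.fst h

end EvenPart

/-- The Lie superalgebra on `A₀ + A₁` defined by a representation of the Lie algebra `A₀` on `A₁`
and an equivariant symmetric bilinear map `A₁ × A₁ → A₀` satisfying the odd Jacobi identity. -/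
def ofRepresentation (ad : A₀ →ₗ[ℝ] Module.End ℝ A₁) (P : A₁ →ₗ[ℝ] A₁ →ₗ[ℝ] A₀)
    (had : ∀ x y, ad ⁅x, y⁆ = ad x * ad y - ad y * ad x) (hsymm : ∀ Q R, P Q R = P R Q)
    (hequiv : ∀ x Q R, ⁅x, P Q R⁆ = P (ad x Q) R + P Q (ad x R))
    (hodd : ∀ Q R T, ad (P Q R) T + ad (P R T) Q + ad (P T Q) R = 0) :
    LieSuperalgebraOn A₀ A₁ where
  br := LinearMap.mk₂ ℝ (fun x y => (⁅x.1, y.1⁆ + P x.2 y.2, ad x.1 y.2 - ad y.1 x.2))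
    (by intro x x' y; refine Prod.ext ?_ ?_ <;> simp [add_add_add_comm, sub_add_sub_comm])
    (by intro r x y; refine Prod.ext ?_ ?_ <;> simp [smul_sub])
    (by intro x y y'; refine Prod.ext ?_ ?_ <;> simp [add_add_add_comm, sub_add_sub_comm])
    (by intro r x y; refine Prod.ext ?_ ?_ <;> simp [smul_sub])
  graded i j := by
    have hadd : (1 : ZMod 2) + 1 = 0 := rfl
    induction i using parity_cases <;> induction j using parity_cases <;>
      simp +contextual [mem_parityPart_zero, mem_parityPart_one, hadd]
  skew i j := by
    induction i using parity_cases <;> induction j using parity_cases <;>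
      rintro ⟨x, Q⟩ hx ⟨y, R⟩ hy <;>
      simp only [mem_parityPart_zero, mem_parityPart_one] at hx hy <;> subst hx hy
    case odd.odd => simp [ZMod.val_one, hsymm Q]
    all_goals simp
  jacobi i j := by
    induction i using parity_cases <;> induction j using parity_cases <;>
      rintro ⟨x, Q⟩ hx ⟨y, R⟩ hy ⟨z, T⟩ <;>
      simp only [mem_parityPart_zero, mem_parityPart_one] at hx hy <;> subst hx hy <;>
      simp only [LinearMap.mk₂_apply, ZMod.val_one, ZMod.val_zero, zero_lie, zero_add, lie_zero,
        add_zero, map_zero, LinearMap.zero_apply, zero_sub, sub_zero, mul_one, mul_zero,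
        pow_one, pow_zero, neg_smul, one_smul, neg_neg, neg_zero, map_neg, Prod.mk_add_mk,
        Prod.neg_mk, Prod.mk.injEq, LinearMap.sub_apply, LinearMap.neg_apply,
        Module.End.mul_apply, had, hequiv]
    case even.even => exact ⟨leibniz_lie x y z, by abel⟩
    case even.odd => exact ⟨trivial, by abel⟩
    case odd.even => exact ⟨by abel, by abel⟩
    case odd.odd =>
      refine ⟨?_, ?_⟩
      · rw [← lie_skew, hequiv, hsymm R]
        abel
      · rw [neg_eq_iff_add_eq_zero, hsymm Q T, ← hodd Q R T]
        abel

end LieSuperalgebraOn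

end LieSuperalgebra

/-! ### Brackets in the Cahen-Wallach algebra and in its superizations -/

section Components

variable {E : Type*} [NormedAddCommGroup E] [InnerProductSpace ℝ E] (b : CWForm E)

theorem inDual_fst (ξ : Module.Dual ℝ E) : (inDual b ξ).1 = ξ := rfl
theorem inDual_snd (ξ : Module.Dual ℝ E) : (inDual b ξ).2 = (0 : Mink E) := rfl
theorem inMink_fst (v : Mink E) : (inMink b v).1 = 0 := rfl
theorem inMink_snd (v : Mink E) : (inMink b v).2 = v := rfl
theorem zero_c1 : (0 : CWAlg b).1 = 0 := rfl
theorem zero_c2 : (0 : CWAlg b).2.1 = 0 := rfl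
theorem zero_c3 : (0 : CWAlg b).2.2.1 = 0 := rfl
theorem zero_c4 : (0 : CWAlg b).2.2.2 = 0 := rfl

variable {b}

theorem elP_ne_zero : elP b ≠ 0 := fun h =>
  one_ne_zero (α := ℝ) (congrArg (fun x : CWAlg b => x.2.2.1) h)

theorem CWAlg.decompose (x : CWAlg b) :
    x = inDual b x.1 + inE b x.2.1 + x.2.2.1 • elP b + x.2.2.2 • elQ b := by
  refine CWAlg.ext b ?_ ?_ ?_ ?_ <;>
    simp [add_c1, add_c2, add_c3, add_c4, smul_c1, smul_c2, smul_c3, smul_c4, inDual_fst,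
      inDual_snd, inMink_fst, inMink_snd, inE, elP, elQ]

variable [FiniteDimensional ℝ E]

theorem CWForm.B_surjective (b : CWForm E) : Function.Surjective b.B := by
  refine LinearMap.injective_iff_surjective.mp ((injective_iff_map_eq_zero _).mpr fun e he => ?_)
  refine b.nondeg.1 e fun f => ?_
  rw [b.form_eq, he, map_zero, LinearMap.zero_apply, neg_zero]

theorem lie_inDual_inE (ξ : Module.Dual ℝ E) (e : E) :
    ⁅inDual b ξ, inE b e⁆ = b.form ((flat E).symm ξ) e • elP b := by
  rw [lie_def]
  refine CWAlg.ext b ?_ ?_ ?_ ?_ <;>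
    simp [br_c1, br_c2, br_c3, br_c4, smul_c1, smul_c2, smul_c3, smul_c4, inDual_fst, inDual_snd,
      inMink_fst, inMink_snd, inE, elP]

theorem lie_inDual_elQ (ξ : Module.Dual ℝ E) :
    ⁅inDual b ξ, elQ b⁆ = inE b (b.B ((flat E).symm ξ)) := by
  rw [lie_def]
  refine CWAlg.ext b ?_ ?_ ?_ ?_ <;>
    simp [br_c1, br_c2, br_c3, br_c4, inDual_fst, inDual_snd, inMink_fst, inMink_snd, inE, elQ]

theorem lie_elQ_inE (e : E) : ⁅elQ b, inE b e⁆ = inDual b (flat E e) := by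
  rw [lie_def]
  refine CWAlg.ext b ?_ ?_ ?_ ?_ <;>
    simp [br_c1, br_c2, br_c3, br_c4, inDual_fst, inDual_snd, inMink_fst, inMink_snd, inE, elQ]

theorem lie_elP (x : CWAlg b) : ⁅x, elP b⁆ = 0 := by
  rw [lie_def]
  refine CWAlg.ext b ?_ ?_ ?_ ?_ <;>
    simp [br_c1, br_c2, br_c3, br_c4, zero_c1, zero_c2, zero_c3, zero_c4, inMink_fst, inMink_snd,
      elP]

end Components

namespace Superization

variable {E : Type*} [NormedAddCommGroup E] [InnerProductSpace ℝ E] [FiniteDimensional ℝ E]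
  {V : Type*} [AddCommGroup V] [Module ℝ V] {b : CWForm E}
  {ρ : Cl (euc E) →ₐ[ℝ] Module.End ℝ V} (g : Superization b ρ)

theorem adOdd_eq_act (x : CWAlg b) : g.adOdd x = g.act x := rfl

theorem oddBr_eq_oddBracket (Q R : V × V) : g.oddBr Q R = g.oddBracket Q R := rfl

theorem adOdd_lie (x y : CWAlg b) :
    g.adOdd ⁅x, y⁆ = g.adOdd x * g.adOdd y - g.adOdd y * g.adOdd x :=
  LieSuperalgebraOn.act_lie g.even_part x y

theorem lie_oddBr (x : CWAlg b) (Q R : V × V) :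
    ⁅x, g.oddBr Q R⁆ = g.oddBr (g.adOdd x Q) R + g.oddBr Q (g.adOdd x R) :=
  LieSuperalgebraOn.lie_oddBracket g.even_part x Q R

theorem adOdd_decompose (x : CWAlg b) : g.adOdd x = g.adOdd (inDual b x.1) +
    g.adOdd (inE b x.2.1) + x.2.2.1 • g.adOdd (elP b) + x.2.2.2 • g.adOdd (elQ b) := by
  simp only [adOdd_eq_act, ← map_smul, ← map_add, ← CWAlg.decompose]

theorem adOdd_inDual (ξ : Module.Dual ℝ E) :
    g.adOdd (inDual b ξ) = √2 • block 0 (ρ (vec _ (b.B ((flat E).symm ξ)))) 0 0 := by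
  rw [← isotropySpin_eq_block]
  exact LinearMap.ext fun Q => congrArg Prod.snd (g.spin ξ Q)

theorem ext_of_adOdd_of_oddBr {g g' : Superization b ρ} (had : ∀ x, g.adOdd x = g'.adOdd x)
    (hodd : ∀ Q R, g.oddBr Q R = g'.oddBr Q R) : g = g' := by
  have hbr : g.toLieSuperalgebraOn = g'.toLieSuperalgebraOn := by
    refine LieSuperalgebraOn.br_injective (LinearMap.ext₂ ?_)
    rintro ⟨x, Q⟩ ⟨y, R⟩
    rw [LieSuperalgebraOn.br_mk g.even_part, LieSuperalgebraOn.br_mk g'.even_part]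
    simp only [← adOdd_eq_act, ← oddBr_eq_oddBracket, had, hodd]
  obtain ⟨_, _, _⟩ := g
  obtain ⟨_, _, _⟩ := g'
  subst hbr
  rfl

end Superization

/-! ### The superization defined by the data -/

namespace SuperizationData

variable {E : Type*} [NormedAddCommGroup E] [InnerProductSpace ℝ E] [FiniteDimensional ℝ E]
  {V : Type*} [AddCommGroup V] [Module ℝ V] {b : CWForm E}
  {ρ : Cl (euc E) →ₐ[ℝ] Module.End ℝ V} {Sm Sp : Submodule ℝ V}
  (D : SuperizationData b ρ Sm Sp)

/-- The Clifford element `B ξ♯ - (L_{c₁} - R_{c₂}) e` whose `√2`-fold is the upper right block of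
the action of `ξ + e`. -/
def upperRight : CWAlg b →ₗ[ℝ] Cl (euc E) where
  toFun x := vec _ (b.B ((flat E).symm x.1)) - leftSubRight ℝ D.c₁ D.c₂ (vec _ x.2.1)
  map_add' x y := by
    simp only [add_c1, add_c2, map_add]
    abel
  map_smul' r x := by
    simp only [smul_c1, smul_c2, map_smul, RingHom.id_apply, smul_sub]

theorem upperRight_apply (x : CWAlg b) : D.upperRight x =
    vec _ (b.B ((flat E).symm x.1)) - leftSubRight ℝ D.c₁ D.c₂ (vec _ x.2.1) := rfl

theorem upperRight_lie (x y : CWAlg b) : D.upperRight ⁅x, y⁆ =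
    x.2.2.2 • leftSubRight ℝ D.c₁ D.c₂ (D.upperRight y) -
      y.2.2.2 • leftSubRight ℝ D.c₁ D.c₂ (D.upperRight x) := by
  have hsq (e : E) : leftSubRight ℝ D.c₁ D.c₂ (leftSubRight ℝ D.c₁ D.c₂ (vec _ e)) =
      -vec _ (b.B e) := by
    rw [← quadraticClifford_iff.mp D.quadratic e, pow_two, Module.End.mul_apply]
  simp only [upperRight_apply, lie_def, br_c1, br_c2, map_sub, map_smul,
    LinearEquiv.symm_apply_apply, hsq]
  module

/-- The representation of the Cahen-Wallach algebra on `S` defined by the data. -/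
def action : CWAlg b →ₗ[ℝ] Module.End ℝ (V × V) where
  toFun x := block (x.2.2.2 • ρ D.c₁) (√2 • ρ (D.upperRight x) + x.2.2.2 • ρ D.c₃) 0
    (x.2.2.2 • ρ D.c₂)
  map_add' x y := by
    simp only [map_add, add_c4, block_add, block_inj]
    refine ⟨?_, ?_, ?_, ?_⟩ <;> module
  map_smul' r x := by
    simp only [map_smul, smul_c4, smul_block, block_inj, RingHom.id_apply]
    refine ⟨?_, ?_, ?_, ?_⟩ <;> module

theorem action_eq_block (x : CWAlg b) : D.action x = block (x.2.2.2 • ρ D.c₁)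
    (√2 • ρ (D.upperRight x) + x.2.2.2 • ρ D.c₃) 0 (x.2.2.2 • ρ D.c₂) := rfl

theorem action_lie (x y : CWAlg b) :
    D.action ⁅x, y⁆ = D.action x * D.action y - D.action y * D.action x := by
  have hq : (⁅x, y⁆ : CWAlg b).2.2.2 = 0 := rfl
  simp only [action_eq_block, block_mul, block_sub, block_inj, upperRight_lie, hq,
    leftSubRight_apply, map_sub, map_smul, map_mul, mul_zero, zero_mul, add_zero, zero_smul,
    mul_add, add_mul, smul_mul_assoc, mul_smul_comm]
  refine ⟨?_, ?_, ?_, ?_⟩ <;> module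

theorem action_elP : D.action (elP b) = 0 := by
  refine LinearMap.ext fun Q => ?_
  simp [action_eq_block, block_apply, upperRight_apply, elP, inMink_fst, inMink_snd]

theorem action_inDual (ξ : Module.Dual ℝ E) : D.action (inDual b ξ) = isotropySpin b ρ ξ := by
  rw [isotropySpin_eq_block, action_eq_block, smul_block, block_inj]
  simp [upperRight_apply, inDual_fst, inDual_snd]

theorem action_elQ : D.action (elQ b) = block (ρ D.c₁) (ρ D.c₃) 0 (ρ D.c₂) := by
  rw [action_eq_block, block_inj]
  simp [upperRight_apply, elQ, inMink_fst, inMink_snd]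

theorem action_inE (e : E) : D.action (inE b e) =
    √2 • block 0 (ρ (vec _ e) ∘ₗ ρ D.c₂ - ρ D.c₁ ∘ₗ ρ (vec _ e)) 0 0 := by
  rw [action_eq_block, smul_block, block_inj]
  simp [upperRight_apply, leftSubRight_apply, inE, inMink_fst, inMink_snd, Module.End.mul_eq_comp]

/-- The coefficient of `p` in the bracket of odd elements. -/
def pairing : LinearMap.BilinForm ℝ (V × V) :=
  D.ppp.compl₁₂ (LinearMap.snd ℝ V V) (LinearMap.snd ℝ V V) +
    D.pmp.compl₁₂ (LinearMap.fst ℝ V V) (LinearMap.snd ℝ V V) +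
      D.pmp.flip.compl₁₂ (LinearMap.snd ℝ V V) (LinearMap.fst ℝ V V)

theorem pairing_apply (Q R : V × V) :
    D.pairing Q R = D.ppp Q.2 R.2 + D.pmp Q.1 R.2 + D.pmp R.1 Q.2 := rfl

theorem pairing_comm (Q R : V × V) : D.pairing Q R = D.pairing R Q := by
  rw [pairing_apply, pairing_apply, D.ppp_symm]
  ring

theorem pmp_upperRight (x : CWAlg b) (s t : V) :
    D.pmp (ρ (D.upperRight x) s) t = -D.pmp (ρ (D.upperRight x) t) s := by
  have hskew := mem_vecSkewForms.mp (bilTauSigmaNeg_le_vecSkewForms D.pmp_mem)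
  have hc (s t : V) : D.pmp s (ρ D.c₂ t) = -D.pmp (ρ D.c₁ s) t :=
    eq_neg_of_add_eq_zero_right (D.compat₂ s t)
  have hvec (e : E) (s t : V) : D.pmp (ρ (vec _ e) (ρ D.c₂ s)) t =
      D.pmp (ρ D.c₁ (ρ (vec _ e) t)) s := by
    rw [hskew, hc, neg_neg]
  simp only [upperRight_apply, leftSubRight_apply, map_sub, map_mul, LinearMap.sub_apply,
    Module.End.mul_apply, hvec]
  rw [hskew]
  ring

theorem pairing_action (x : CWAlg b) (Q R : V × V) :
    D.pairing (D.action x Q) R + D.pairing Q (D.action x R) = 0 := by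
  simp only [pairing_apply, action_eq_block, block_apply, map_add, map_smul, LinearMap.add_apply,
    LinearMap.smul_apply, LinearMap.zero_apply, smul_eq_mul, zero_add]
  linear_combination x.2.2.2 * (D.compat₁ Q.2 R.2 + D.compat₂ Q.1 R.2 + D.compat₂ R.1 Q.2) +
    √2 * D.pmp_upperRight x Q.2 R.2

/-- The Lie superalgebra structure on `𝔤_b + S` defined by the data. -/
def lieSuperalgebra : LieSuperalgebraOn (CWAlg b) (V × V) :=
  LieSuperalgebraOn.ofRepresentation D.action
    (D.pairing.compr₂ (LinearMap.toSpanSingleton ℝ (CWAlg b) (elP b))) D.action_lie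
    (fun Q R => by simp only [LinearMap.compr₂_apply, D.pairing_comm Q])
    (fun x Q R => by
      simp only [LinearMap.compr₂_apply, LinearMap.toSpanSingleton_apply]
      rw [← add_smul, D.pairing_action, lie_smul, lie_elP, smul_zero, zero_smul])
    (fun Q R T => by
      simp only [LinearMap.compr₂_apply, LinearMap.toSpanSingleton_apply, map_smul, action_elP,
        smul_zero, LinearMap.zero_apply, add_zero])

/-- The superization of the Cahen-Wallach algebra defined by the data. -/
def superization : Superization b ρ where
  toLieSuperalgebraOn := D.lieSuperalgebra
  even_part x y := by simp [lieSuperalgebra, LieSuperalgebraOn.ofRepresentation]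
  spin ξ Q := by
    simp [lieSuperalgebra, LieSuperalgebraOn.ofRepresentation, action_inDual]

theorem adOdd_superization (x : CWAlg b) : D.superization.adOdd x = D.action x := by
  refine LinearMap.ext fun Q => ?_
  simp [Superization.adOdd, superization, lieSuperalgebra, LieSuperalgebraOn.ofRepresentation]

theorem oddBr_superization (Q R : V × V) :
    D.superization.oddBr Q R = D.pairing Q R • elP b := by
  simp [Superization.oddBr, superization, lieSuperalgebra, LieSuperalgebraOn.ofRepresentation]

theorem superization_isGivenBy : D.superization.IsGivenBy D where
  ad_p := by rw [adOdd_superization, action_elP]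
  ad_q := by rw [adOdd_superization, action_elQ]
  ad_dual e := by rw [Superization.adOdd_inDual, LinearEquiv.symm_apply_apply]
  ad_E e := by rw [adOdd_superization, action_inE]
  odd Q := by
    rw [oddBr_superization, pairing_apply]
    congr 1
    ring

theorem superization_isZeroChargeTranslational : D.superization.IsZeroChargeTranslational where
  zero_charge := D.superization_isGivenBy.ad_p
  clifford v := by
    obtain ⟨c, hc : spinRep ρ c = _⟩ := block_mem_range_spinRep ρ (v.2.2 • D.c₁)
      (√2 • D.upperRight (inMink b v) + v.2.2 • D.c₃) 0 (v.2.2 • D.c₂)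
    refine ⟨c, ?_⟩
    rw [adOdd_superization, action_eq_block, inMink_snd]
    simpa only [map_smul, map_add, map_zero] using hc.symm
  translational Q R := ⟨(0, D.pairing Q R, 0), by
    rw [oddBr_superization, elP, ← map_smul]
    simp⟩

end SuperizationData

namespace Superization.IsGivenBy

variable {E : Type*} [NormedAddCommGroup E] [InnerProductSpace ℝ E] [FiniteDimensional ℝ E]
  {V : Type*} [AddCommGroup V] [Module ℝ V] {b : CWForm E}
  {ρ : Cl (euc E) →ₐ[ℝ] Module.End ℝ V} {Sm Sp : Submodule ℝ V}
  {g g' : Superization b ρ} {D D' : SuperizationData b ρ Sm Sp}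

theorem oddBr_eq (h : g.IsGivenBy D) (Q R : V × V) : g.oddBr Q R = D.pairing Q R • elP b := by
  rw [oddBr_eq_oddBracket, LieSuperalgebraOn.oddBracket_polarize]
  simp only [← oddBr_eq_oddBracket, h.odd, ← sub_smul, smul_smul]
  congr 1
  simp only [D.pairing_apply, Prod.fst_add, Prod.snd_add, map_add, LinearMap.add_apply,
    D.ppp_symm R.2 Q.2]
  ring

theorem unique (h : g.IsGivenBy D) (h' : g'.IsGivenBy D) : g' = g := by
  refine ext_of_adOdd_of_oddBr (fun x => ?_) fun Q R => by rw [h.oddBr_eq, h'.oddBr_eq]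
  rw [g.adOdd_decompose, g'.adOdd_decompose, h.ad_p, h'.ad_p, h.ad_q, h'.ad_q, h.ad_E, h'.ad_E,
    g.adOdd_inDual, g'.adOdd_inDual]

theorem data_eq (h : g.IsGivenBy D) (h' : g.IsGivenBy D') :
    ρ D.c₁ = ρ D'.c₁ ∧ ρ D.c₂ = ρ D'.c₂ ∧ ρ D.c₃ = ρ D'.c₃ ∧ D.pmp = D'.pmp ∧ D.ppp = D'.ppp := by
  obtain ⟨h₁, h₃, -, h₂⟩ := block_inj.mp (h.ad_q.symm.trans h'.ad_q)
  have hpairing (Q R : V × V) : D.pairing Q R = D'.pairing Q R :=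
    smul_left_injective ℝ elP_ne_zero ((h.oddBr_eq Q R).symm.trans (h'.oddBr_eq Q R))
  refine ⟨h₁, h₂, h₃, LinearMap.ext₂ fun s t => ?_, LinearMap.ext₂ fun s t => ?_⟩
  · simpa [SuperizationData.pairing_apply] using hpairing (s, 0) (0, t)
  · simpa [SuperizationData.pairing_apply] using hpairing (0, s) (0, t)

theorem congr_data (h : g.IsGivenBy D) (h₁ : ρ D.c₁ = ρ D'.c₁) (h₂ : ρ D.c₂ = ρ D'.c₂)
    (h₃ : ρ D.c₃ = ρ D'.c₃) (hmp : D.pmp = D'.pmp) (hpp : D.ppp = D'.ppp) : g.IsGivenBy D' where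
  ad_p := h.ad_p
  ad_q := by rw [h.ad_q, h₁, h₂, h₃]
  ad_dual := h.ad_dual
  ad_E e := by rw [h.ad_E, h₁, h₂]
  odd Q := by rw [h.odd, hmp, hpp]

theorem isGivenBy_iff (h : g.IsGivenBy D) : g.IsGivenBy D' ↔
    ρ (D.c₁ - D'.c₁) = 0 ∧ ρ (D.c₂ - D'.c₂) = 0 ∧ ρ (D.c₃ - D'.c₃) = 0 ∧
      D.pmp = D'.pmp ∧ D.ppp = D'.ppp := by
  simp only [map_sub, sub_eq_zero]
  exact ⟨h.data_eq, fun ⟨h₁, h₂, h₃, hmp, hpp⟩ => h.congr_data h₁ h₂ h₃ hmp hpp⟩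

end Superization.IsGivenBy

/-! ### Zero charge superizations with translational supersymmetry -/

namespace Superization

variable {E : Type*} [NormedAddCommGroup E] [InnerProductSpace ℝ E] [FiniteDimensional ℝ E]
  {V : Type*} [AddCommGroup V] [Module ℝ V] {b : CWForm E}
  {ρ : Cl (euc E) →ₐ[ℝ] Module.End ℝ V} (g : Superization b ρ)

section ActionOfQ

variable {g} {x y z t : Module.End ℝ V}

theorem adOdd_inE_of_adOdd_elQ (hq : g.adOdd (elQ b) = block x y z t) (e : E) :
    g.adOdd (inE b e) = √2 • block (ρ (vec _ e) * z) (ρ (vec _ e) * t - x * ρ (vec _ e)) 0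
      (-(z * ρ (vec _ e))) := by
  obtain ⟨f, rfl⟩ := b.B_surjective e
  have hbracket : inE b (b.B f) = ⁅inDual b (flat E f), elQ b⁆ := by
    rw [lie_inDual_elQ, LinearEquiv.symm_apply_apply]
  rw [hbracket, adOdd_lie, adOdd_inDual, LinearEquiv.symm_apply_apply, hq, smul_block,
    smul_block, block_mul, block_mul, block_sub, block_inj]
  simp [smul_sub]

theorem lowerLeft_eq_zero [Nontrivial E] (hp : g.adOdd (elP b) = 0)
    (hq : g.adOdd (elQ b) = block x y z t) : z = 0 := by
  obtain ⟨e, he⟩ := exists_ne (0 : E)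
  obtain ⟨f, rfl⟩ := b.B_surjective e
  have hlie := g.adOdd_lie (inDual b (flat E f)) (inE b (b.B f))
  rw [lie_inDual_inE, adOdd_eq_act, map_smul, ← adOdd_eq_act, hp, smul_zero, adOdd_inDual,
    LinearEquiv.symm_apply_apply, adOdd_inE_of_adOdd_elQ hq] at hlie
  have hzvec (s : V) : z (ρ (vec _ (b.B f)) s) = 0 := by
    refine eq_zero_of_vec_apply_eq_zero (ρ := ρ) he ?_
    have hs := congrArg Prod.fst (LinearMap.congr_fun hlie (0, s))
    simp only [LinearMap.zero_apply, LinearMap.sub_apply, Module.End.mul_apply,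
      LinearMap.smul_apply, block_apply, Prod.fst_sub, Prod.fst_zero, Prod.smul_fst, map_zero,
      zero_add, add_zero, LinearMap.neg_apply, map_neg, map_smul] at hs
    have hsandwich : (√2 * √2 * 2) • ρ (vec _ (b.B f)) (z (ρ (vec _ (b.B f)) s)) = 0 := by
      rw [← neg_eq_zero, hs]
      module
    exact (smul_eq_zero.mp hsandwich).resolve_left (by positivity)
  refine LinearMap.ext fun s => ?_
  have hs := hzvec (ρ (vec _ (b.B f)) s)
  rw [vec_vec_apply, map_smul] at hs
  exact (smul_eq_zero.mp hs).resolve_left (inner_self_ne_zero.mpr he)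

theorem leftSubRight_sq_vec (hq : g.adOdd (elQ b) = block x y 0 t) (e : E) :
    (leftSubRight ℝ x t ^ 2) (ρ (vec _ e)) = -ρ (vec _ (b.B e)) := by
  have hlie := g.adOdd_lie (elQ b) (inE b e)
  rw [lie_elQ_inE, adOdd_inDual, LinearEquiv.symm_apply_apply, adOdd_inE_of_adOdd_elQ hq, hq,
    smul_block, smul_block, block_mul, block_mul, block_sub, block_inj] at hlie
  have hupper : √2 • ρ (vec _ (b.B e)) = √2 • (x * (ρ (vec _ e) * t - x * ρ (vec _ e)) -
      (ρ (vec _ e) * t - x * ρ (vec _ e)) * t) := by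
    simp only [hlie.2.1, mul_smul_comm, smul_mul_assoc, smul_zero, mul_zero, zero_mul, neg_zero,
      add_zero, zero_add]
    module
  have hsqrt : √2 ≠ 0 := by positivity
  simp only [pow_two, Module.End.mul_apply, leftSubRight_apply,
    smul_right_injective (Module.End ℝ V) hsqrt hupper]
  noncomm_ring

theorem IsZeroChargeTranslational.exists_adOdd_elQ_eq_block [Nontrivial E] [Nontrivial V]
    (h : g.IsZeroChargeTranslational) : ∃ c₁ c₂ c₃, QuadraticClifford b c₁ c₂ ∧
      g.adOdd (elQ b) = block (ρ c₁) (ρ c₃) 0 (ρ c₂) := by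
  obtain ⟨c, hc⟩ := h.clifford (0, 0, 1)
  obtain ⟨a₁, c₃, z, a₂, hblock⟩ := exists_spinRep_eq_block ρ c
  have hq : g.adOdd (elQ b) = block (ρ a₁) (ρ c₃) (ρ z) (ρ a₂) := hc.trans hblock
  rw [lowerLeft_eq_zero h.zero_charge hq] at hq
  obtain ⟨c₁, c₂, h₁, h₂, hquad⟩ :=
    exists_quadraticClifford_lift b ρ a₁ a₂ (leftSubRight_sq_vec hq)
  exact ⟨c₁, c₂, c₃, hquad, by rw [hq, h₁, h₂]⟩

end ActionOfQ

/-- The coefficient of `p` in the bracket of odd elements. -/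
def oddCoeff : LinearMap.BilinForm ℝ (V × V) :=
  g.oddBracket.compr₂ (LinearMap.fst ℝ ℝ ℝ ∘ₗ LinearMap.snd ℝ E (ℝ × ℝ) ∘ₗ
    LinearMap.snd ℝ (Module.Dual ℝ E) (Mink E))

theorem oddCoeff_apply (Q R : V × V) : g.oddCoeff Q R = (g.oddBr Q R).2.2.1 := rfl

theorem oddCoeff_comm (Q R : V × V) : g.oddCoeff Q R = g.oddCoeff R Q := by
  rw [oddCoeff_apply, oddCoeff_apply, oddBr_eq_oddBracket, LieSuperalgebraOn.oddBracket_comm]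
  rfl

/-- The restriction of `oddCoeff` to `S₋ × S₊`, which recovers the form `p_{-+}`. -/
def minusPlusForm : LinearMap.BilinForm ℝ V :=
  g.oddCoeff.compl₁₂ (LinearMap.inl ℝ V V) (LinearMap.inr ℝ V V)

/-- The restriction of `oddCoeff` to `S₊ × S₊`, which recovers the form `p_{++}`. -/
def plusPlusForm : LinearMap.BilinForm ℝ V :=
  g.oddCoeff.compl₁₂ (LinearMap.inr ℝ V V) (LinearMap.inr ℝ V V)

namespace IsZeroChargeTranslational

variable {g} (h : g.IsZeroChargeTranslational)

include h

theorem oddBr_fst (Q R : V × V) : (g.oddBr Q R).1 = 0 := by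
  obtain ⟨v, hv⟩ := h.translational Q R
  rw [hv, inMink_fst]

variable [Nontrivial E]

theorem oddBr_eq_oddCoeff_smul (Q R : V × V) : g.oddBr Q R = g.oddCoeff Q R • elP b := by
  -- `E*` has no component in `[S, S]`, and `[q, e] = e♭`, `[e, q] = -e♭`.
  have hcomponent (x : CWAlg b) : (⁅x, g.oddBr Q R⁆ : CWAlg b).1 = 0 := by
    rw [lie_oddBr, add_c1, h.oddBr_fst, h.oddBr_fst, add_zero]
  have hE : (g.oddBr Q R).2.1 = 0 := by
    simpa [lie_def, br_c1, elQ, inMink_snd] using hcomponent (elQ b)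
  have hq : (g.oddBr Q R).2.2.2 = 0 := by
    obtain ⟨e, he⟩ := exists_ne (0 : E)
    simpa [lie_def, br_c1, inE, inMink_snd, he] using hcomponent (inE b e)
  refine CWAlg.ext b ?_ ?_ ?_ ?_ <;>
    simp [h.oddBr_fst, hE, hq, oddCoeff_apply, smul_c1, smul_c2, smul_c3, smul_c4, elP, inMink_fst,
      inMink_snd]

theorem oddCoeff_invariant (x : CWAlg b) (Q R : V × V) :
    g.oddCoeff (g.adOdd x Q) R + g.oddCoeff Q (g.adOdd x R) = 0 := by
  have hlie := g.lie_oddBr x Q R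
  rw [h.oddBr_eq_oddCoeff_smul Q R, lie_smul, lie_elP, smul_zero] at hlie
  rw [oddCoeff_apply, oddCoeff_apply, ← add_c3, ← hlie, zero_c3]

theorem oddCoeff_vec (e : E) (Q R : V × V) :
    g.oddCoeff (ρ (vec _ e) Q.2, 0) R + g.oddCoeff Q (ρ (vec _ e) R.2, 0) = 0 := by
  obtain ⟨f, rfl⟩ := b.B_surjective e
  have hinv := h.oddCoeff_invariant (inDual b (flat E f)) Q R
  rw [adOdd_inDual, LinearEquiv.symm_apply_apply, LinearMap.smul_apply, LinearMap.smul_apply,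
    map_smul, map_smul, LinearMap.smul_apply, ← smul_add] at hinv
  simpa [block_apply] using hinv

theorem oddCoeff_inl_inl (s t : V) : g.oddCoeff (s, 0) (t, 0) = 0 := by
  obtain ⟨e, he⟩ := exists_ne (0 : E)
  have hvec := h.oddCoeff_vec e (0, ρ (vec _ e) s) (t, 0)
  have hsmul : ((inner ℝ e e • s, 0) : V × V) = (inner ℝ e e : ℝ) • (s, 0) := by simp
  rw [vec_vec_apply, map_zero, Prod.mk_zero_zero, map_zero, add_zero, hsmul, map_smul,
    LinearMap.smul_apply] at hvec
  exact (smul_eq_zero.mp hvec).resolve_left (inner_self_ne_zero.mpr he)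

theorem oddCoeff_eq (Q R : V × V) : g.oddCoeff Q R =
    g.plusPlusForm Q.2 R.2 + g.minusPlusForm Q.1 R.2 + g.minusPlusForm R.1 Q.2 := by
  have hsplit (T : V × V) : T = (T.1, 0) + (0, T.2) := by simp
  calc g.oddCoeff Q R = g.oddCoeff ((Q.1, 0) + (0, Q.2)) ((R.1, 0) + (0, R.2)) := by
        rw [← hsplit, ← hsplit]
    _ = g.oddCoeff (Q.1, 0) (R.1, 0) + g.oddCoeff (Q.1, 0) (0, R.2) +
          (g.oddCoeff (R.1, 0) (0, Q.2) + g.oddCoeff (0, Q.2) (0, R.2)) := by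
        rw [map_add, LinearMap.map_add₂, LinearMap.map_add₂, g.oddCoeff_comm (0, Q.2) (R.1, 0)]
        ring
    _ = g.plusPlusForm Q.2 R.2 + g.minusPlusForm Q.1 R.2 + g.minusPlusForm R.1 Q.2 := by
        rw [h.oddCoeff_inl_inl]
        simp only [minusPlusForm, plusPlusForm, LinearMap.compl₁₂_apply, LinearMap.inl_apply,
          LinearMap.inr_apply]
        ring

theorem minusPlusForm_mem_vecSkewForms : g.minusPlusForm ∈ vecSkewForms ρ := by
  refine mem_vecSkewForms.mpr fun e s t => eq_neg_of_add_eq_zero_left ?_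
  simpa [h.oddCoeff_eq] using h.oddCoeff_vec e (0, s) (0, t)

theorem exists_data [Nontrivial V] {Sm Sp : Submodule ℝ V}
    (hS : ¬ SoIrreducible ρ (⊤ : Submodule ℝ V) → IsCliffordGrading ρ Sm Sp) :
    ∃ D : SuperizationData b ρ Sm Sp, g.IsGivenBy D := by
  obtain ⟨c₁, c₂, c₃, hquad, hq⟩ := h.exists_adOdd_elQ_eq_block
  have hinv := h.oddCoeff_invariant (elQ b)
  simp only [hq, block_apply, h.oddCoeff_eq, LinearMap.zero_apply, zero_add] at hinv
  refine ⟨{ c₁, c₂, c₃, pmp := g.minusPlusForm, ppp := g.plusPlusForm, quadratic := hquad,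
            pmp_mem := ?_, ppp_symm := fun s t => g.oddCoeff_comm _ _,
            compat₁ := fun s t => ?_, compat₂ := fun s t => ?_ },
    { ad_p := h.zero_charge, ad_q := hq, ad_dual := fun e => ?_, ad_E := fun e => ?_,
      odd := fun Q => ?_ }⟩
  · rw [bilTauSigmaNeg_eq_vecSkewForms hS]
    exact h.minusPlusForm_mem_vecSkewForms
  · have hst := hinv (0, s) (0, t)
    simp only [map_zero, LinearMap.zero_apply, zero_add, add_zero] at hst
    linear_combination hst
  · have hst := hinv (s, 0) (0, t)
    simp only [map_zero, LinearMap.zero_apply, zero_add, add_zero] at hst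
    linear_combination hst
  · rw [g.adOdd_inDual, LinearEquiv.symm_apply_apply]
  · rw [adOdd_inE_of_adOdd_elQ hq]
    simp [Module.End.mul_eq_comp]
  · rw [h.oddBr_eq_oddCoeff_smul, h.oddCoeff_eq]
    congr 1
    ring

end IsZeroChargeTranslational

end Superization

end CahenWallach

end

theorem theorem5p1_general
    {E : Type*} [NormedAddCommGroup E] [InnerProductSpace ℝ E] [FiniteDimensional ℝ E]
    [Nontrivial E] (b : CahenWallach.CWForm E)
    {V : Type*} [AddCommGroup V] [Module ℝ V] [Nontrivial V]
    (ρ : CahenWallach.Cl (CahenWallach.euc E) →ₐ[ℝ] Module.End ℝ V)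
    (Sm Sp : Submodule ℝ V)
    (hS : ¬ CahenWallach.SoIrreducible ρ (⊤ : Submodule ℝ V) →
      CahenWallach.IsCliffordGrading ρ Sm Sp) :
    (∀ D : CahenWallach.SuperizationData b ρ Sm Sp,
      ∃ g : CahenWallach.Superization b ρ,
        g.IsZeroChargeTranslational ∧ g.IsGivenBy D ∧
          ∀ g' : CahenWallach.Superization b ρ, g'.IsGivenBy D → g' = g) ∧
    (∀ g : CahenWallach.Superization b ρ, g.IsZeroChargeTranslational →
      ∃ D : CahenWallach.SuperizationData b ρ Sm Sp, g.IsGivenBy D) ∧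
    (∀ (g : CahenWallach.Superization b ρ) (D D' : CahenWallach.SuperizationData b ρ Sm Sp),
      g.IsGivenBy D →
        (g.IsGivenBy D' ↔
          ρ (D.c₁ - D'.c₁) = 0 ∧ ρ (D.c₂ - D'.c₂) = 0 ∧ ρ (D.c₃ - D'.c₃) = 0 ∧
            D.pmp = D'.pmp ∧ D.ppp = D'.ppp)) :=
  ⟨fun D => ⟨D.superization, D.superization_isZeroChargeTranslational, D.superization_isGivenBy,
    fun _ h => D.superization_isGivenBy.unique h⟩,
    fun _ h => h.exists_data hS, fun _ _ _ h => h.isGivenBy_iff⟩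

theorem theorem5p1
    {E : Type*} [NormedAddCommGroup E] [InnerProductSpace ℝ E] [FiniteDimensional ℝ E]
    (n : ℕ) (hn : 2 ≤ n) (hE : Module.finrank ℝ E + 1 = n)
    (b : CahenWallach.CWForm E)
    {V : Type*} [AddCommGroup V] [Module ℝ V]
    (ρ : CahenWallach.Cl (CahenWallach.euc E) →ₐ[ℝ] Module.End ℝ V)
    (hρ : CahenWallach.IsSpinModule ρ)
    (Sm Sp : Submodule ℝ V)
    (hS : ¬ CahenWallach.SoIrreducible ρ (⊤ : Submodule ℝ V) →
      CahenWallach.IsSemispinorSplitting ρ Sm Sp) :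
    -- every admissible set of data defines a unique superization, of the required kind
    (∀ D : CahenWallach.SuperizationData b ρ Sm Sp,
      ∃ g : CahenWallach.Superization b ρ,
        g.IsZeroChargeTranslational ∧ g.IsGivenBy D ∧
          ∀ g' : CahenWallach.Superization b ρ, g'.IsGivenBy D → g' = g) ∧
    -- every superization of the required kind arises in this way
    (∀ g : CahenWallach.Superization b ρ, g.IsZeroChargeTranslational →
      ∃ D : CahenWallach.SuperizationData b ρ Sm Sp, g.IsGivenBy D) ∧
    -- the data are unique, the triple up to elements of the kernel of the spin representation
    (∀ (g : CahenWallach.Superization b ρ) (D D' : CahenWallach.SuperizationData b ρ Sm Sp),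
      g.IsGivenBy D →
        (g.IsGivenBy D' ↔
          ρ (D.c₁ - D'.c₁) = 0 ∧ ρ (D.c₂ - D'.c₂) = 0 ∧ ρ (D.c₃ - D'.c₃) = 0 ∧
            D.pmp = D'.pmp ∧ D.ppp = D'.ppp)) := by
  have ⟨_, _⟩ : Nontrivial E ∧ Nontrivial V :=
    ⟨Module.nontrivial_of_finrank_pos (R := ℝ) (by lia), hρ.1⟩
  exact theorem5p1_general b ρ Sm Sp fun h => (hS h).isCliffordGrading
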